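/- Let $q,d,d',N\ge 1$ be integers, and let $V$ be a reproducing kernel Hilbert space of vector fields $\mathbb R^q\to\mathbb R^q$ with (matrix-valued) kernel $K$. For a matrix $X$ with $b$ columns, $\sigma_{\max}(X)$ and $\sigma_{\min}(X)$ denote the square roots of the largest and of the smallest of the $b$ eigenvalues of $X^\top X$. Norms of vectors are Euclidean, and $\|\cdot\|_{2,\infty}$ is the essential supremum over $\mathbb R^q$ of the operator norm. Assume that $V$ is strongly admissible with constant $\kappa>0$: every $v\in V$ is (the continuous representative of) an element of $W^{2,\infty}(\mathbb R^q,\mathbb R^q)$ and $$\|v\|_\infty+\|Dv\|_{2,\infty}+\|D^2v\|_{2,\infty}\le\kappa\|v\|_V .$$ Assume that $V$ is $N$-universal: writing $\mathbb K(z)=(K(z^i,z^j))_{1\le i,j\le N}$ for the block kernel matrix of $z=(z^1,\dots,z^N)\in(\mathbb R^q)^N$, $$\Lambda:=\sup_{z\in(\mathbb R^q)^N}\lambda_{\max}(\mathbb K(z))<\infty,\qquad \lambda(s):=\inf\Big\{\lambda_{\min}(\mathbb K(z)) : \|z^i-z^j\|\ge s^{-1}\ \text{for all } i\ne j\Big\}>0\quad\text{for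 all } s>0 .$$ Let $A\in\mathbb R^{q\times d}$ with $\sigma_{\min}(A)>0$ and let $B\in\mathbb R^{d'\times q}$. Let $x^1,\dots,x^N\in\mathbb R^d$ be pairwise distinct, with data separation $\delta:=\min_{i\ne j}\|x^i-x^j\|$, and let $y^1,\dots,y^N\in\mathbb R^{d'}$. (If $N=1$ there are no pairs: put $\delta^{-1}:=0$ and let $\lambda(0):=\inf_z\lambda_{\min}(\mathbb K(z))$.) Then for every $v\in L^2([0,1],V)$ and $z_0\in\mathbb R^q$ there is a unique $z\in H^1([0,1],\mathbb R^q)$ with $z_t=z_0+\int_0^t v_s(z_s)\,ds$ for all $t\in[0,1]$. Let $F(v,x):=Bz_1$, where $z$ is this solution for $z_0=Ax$, be the output of the RKHS-FlowResNet, and let $$L(v):=\frac1{2N}\sum_{i=1}^N\|F(v,x^i)-y^i\|^2,\qquad v\in L^2([0,1],V),$$ be its empirical risk. Then $L$ is (Fréchet) differentiable on $L^2([0,1],V)$, and for every $v\in L^2([0,1],V)$, with $\|v\|=\|v\|_{L^2}$, $$2\,m(\|v\|)\,L(v)\ \le\ \|\nabla L(v)\|^2\ \le\ 2\,M(\|v\|)\,L(v),$$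 where, for $R\ge 0$, $$M(R)=\frac1N\,\sigma_{\max}(B^\top)^2\,\Lambda\,e^{2\kappa R},\qquad m(R)=\frac1N\,\sigma_{\min}(B^\top)^2\,\lambda\big(\sigma_{\min}(A)^{-1}\delta^{-1}e^{\kappa R}\big)\,e^{-2\kappa R}.$$ If moreover $\sigma_{\min}(B^\top)>0$, then $m$ and $M$ are positive and continuous on $[0,\infty)$, so that $L$ satisfies the local Polyak-Lojasiewicz property with the functions $m$ and $M$. -/

import Mathlib

open MeasureTheory Set
open scoped ContDiff

noncomputable section

namespace FlowResNet

/-- `ℝⁿ` with the Euclidean norm. -/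
abbrev Vec (n : ℕ) : Type := EuclideanSpace ℝ (Fin n)

/-! ### Matrices -/

/-- The largest singular value of a real matrix. -/
def sigmaMax {a b : ℕ} (M : Matrix (Fin a) (Fin b) ℝ) : ℝ :=
  (Matrix.toEuclideanLin M).singularValues 0

/-- The smallest singular value of a real matrix `M` with `b` columns: the square root of the
smallest of the `b` eigenvalues of `Mᵀ M` (so it is `0` if `M` is not injective). `singularValues`
lists these square roots in decreasing order, starting at index `0`. -/
def sigmaMin {a b : ℕ} (M : Matrix (Fin a) (Fin b) ℝ) : ℝ :=
  (Matrix.toEuclideanLin M).singularValues (b - 1)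

/-- The largest eigenvalue of a real symmetric matrix. -/
def lambdaMax {ι : Type*} [Fintype ι] [DecidableEq ι] (M : Matrix ι ι ℝ) : ℝ :=
  sSup (spectrum ℝ M)

/-- The smallest eigenvalue of a real symmetric matrix. -/
def lambdaMin {ι : Type*} [Fintype ι] [DecidableEq ι] (M : Matrix ι ι ℝ) : ℝ :=
  sInf (spectrum ℝ M)

/-! ### Strong admissibility: the embedding into `W^{2,∞}` -/

/-- `g` is the weak (distributional) total derivative of `f` on `ℝ^q`. -/
def IsWeakFDeriv {q : ℕ} {F : Type*} [NormedAddCommGroup F] [NormedSpace ℝ F]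
    (f : Vec q → F) (g : Vec q → Vec q →L[ℝ] F) : Prop :=
  LocallyIntegrable f volume ∧ LocallyIntegrable g volume ∧
    ∀ φ : Vec q → ℝ, ContDiff ℝ ∞ φ → HasCompactSupport φ → ∀ e : Vec q,
      ∫ x, (fderiv ℝ φ x e) • f x = - ∫ x, φ x • g x e

/-- `V` is strongly admissible with constant `κ`: each `v ∈ V` is the continuous representative of
an element of `W^{2,∞}(ℝ^q, ℝ^q)`, and the essential suprema of `|v|`, of the operator norm of its
weak derivative and of the operator norm of its second weak derivative add up to at most
`κ ‖v‖_V`. -/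
def IsStronglyAdmissible {q : ℕ} (V : Type*) [NormedAddCommGroup V] [InnerProductSpace ℝ V]
    [RKHS ℝ V (Vec q) (Vec q)] (κ : ℝ) : Prop :=
  0 < κ ∧ ∀ v : V, Continuous (v : Vec q → Vec q) ∧
    ∃ (Dv : Vec q → Vec q →L[ℝ] Vec q) (D2v : Vec q → Vec q →L[ℝ] Vec q →L[ℝ] Vec q),
      IsWeakFDeriv (v : Vec q → Vec q) Dv ∧ IsWeakFDeriv Dv D2v ∧
      eLpNorm (v : Vec q → Vec q) ⊤ volume + eLpNorm Dv ⊤ volume + eLpNorm D2v ⊤ volume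
        ≤ ENNReal.ofReal (κ * ‖v‖)

/-! ### `N`-universality -/

/-- The block kernel matrix `(K(zⁱ, zʲ))_{i,j}`, as a real matrix of size `Nq`. -/
def kernelMatrix {q N : ℕ} (V : Type*) [NormedAddCommGroup V] [InnerProductSpace ℝ V]
    [CompleteSpace V] [RKHS ℝ V (Vec q) (Vec q)] (z : Fin N → Vec q) :
    Matrix (Fin N × Fin q) (Fin N × Fin q) ℝ :=
  Matrix.of fun ia jb => RKHS.kernel V (z ia.1) (z jb.1) (EuclideanSpace.single jb.2 1) ia.2

/-- The set of largest eigenvalues of the kernel matrices of `N` points. -/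
def topEigenvalues {q : ℕ} (V : Type*) [NormedAddCommGroup V] [InnerProductSpace ℝ V]
    [CompleteSpace V] [RKHS ℝ V (Vec q) (Vec q)] (N : ℕ) : Set ℝ :=
  {r | ∃ z : Fin N → Vec q, r = lambdaMax (kernelMatrix V z)}

/-- `Λ`, the supremum of the largest eigenvalues of the kernel matrices of `N` points. -/
def bigLambda {q : ℕ} (V : Type*) [NormedAddCommGroup V] [InnerProductSpace ℝ V]
    [CompleteSpace V] [RKHS ℝ V (Vec q) (Vec q)] (N : ℕ) : ℝ :=
  sSup (topEigenvalues V N)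

/-- The function `λ`: for `s = δ⁻¹`, the infimum of the smallest eigenvalues of the kernel matrices
of `N` points at pairwise distance at least `δ = s⁻¹`. -/
def smallLambda {q : ℕ} (V : Type*) [NormedAddCommGroup V] [InnerProductSpace ℝ V]
    [CompleteSpace V] [RKHS ℝ V (Vec q) (Vec q)] (N : ℕ) (s : ℝ) : ℝ :=
  sInf {r | ∃ z : Fin N → Vec q, (∀ i j, i ≠ j → s⁻¹ ≤ ‖z i - z j‖) ∧
    r = lambdaMin (kernelMatrix V z)}

/-- `V` is `N`-universal: `Λ < ∞`, and `λ(δ⁻¹) > 0` for every `δ > 0`. -/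
def IsUniversal {q : ℕ} (V : Type*) [NormedAddCommGroup V] [InnerProductSpace ℝ V]
    [CompleteSpace V] [RKHS ℝ V (Vec q) (Vec q)] (N : ℕ) : Prop :=
  BddAbove (topEigenvalues V N) ∧ ∀ δ : ℝ, 0 < δ → 0 < smallLambda V N δ⁻¹

/-! ### The model and its empirical risk -/

/-- Lebesgue measure on `[0,1]`. -/
abbrev unitTime : Measure ℝ := volume.restrict (Icc (0 : ℝ) 1)

/-- The space `L²([0,1], V)` of control parameters. -/
abbrev Control (V : Type*) [NormedAddCommGroup V] : Type _ := Lp V 2 unitTime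

/-- `z` solves the forward problem `ż_t = v_t(z_t)`, `z_0 = x₀` on `[0,1]` in the sense of `H¹`
functions: `t ↦ v_t(z_t)` is square integrable, and `z` is its primitive starting at `x₀`. Only the
values of `z` on `[0,1]` matter. -/
def IsForwardSolution {q : ℕ} {V : Type*} [NormedAddCommGroup V] [InnerProductSpace ℝ V]
    [RKHS ℝ V (Vec q) (Vec q)] (v : Control V) (x₀ : Vec q) (z : ℝ → Vec q) : Prop :=
  MemLp (fun s => (v s : V) (z s)) 2 unitTime ∧
    ∀ t ∈ Icc (0 : ℝ) 1, z t = x₀ + ∫ s in (0 : ℝ)..t, (v s : V) (z s)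

/-- The solution of the forward problem (an arbitrary function if there is none). -/
def forwardSolution {q : ℕ} {V : Type*} [NormedAddCommGroup V] [InnerProductSpace ℝ V]
    [RKHS ℝ V (Vec q) (Vec q)] (v : Control V) (x₀ : Vec q) : ℝ → Vec q :=
  Classical.epsilon fun z => IsForwardSolution v x₀ z

/-- The output `F(v, x) = B z_1` of the RKHS-FlowResNet, where `ż_t = v_t(z_t)`, `z_0 = A x`. -/
def output {q d d' : ℕ} {V : Type*} [NormedAddCommGroup V] [InnerProductSpace ℝ V]
    [RKHS ℝ V (Vec q) (Vec q)] (A : Matrix (Fin q) (Fin d) ℝ) (B : Matrix (Fin d') (Fin q) ℝ)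
    (v : Control V) (x : Vec d) : Vec d' :=
  Matrix.toEuclideanLin B (forwardSolution v (Matrix.toEuclideanLin A x) 1)

/-- The empirical risk `L(v) = (1 / 2N) ∑ᵢ ‖F(v, xⁱ) - yⁱ‖²`. -/
def empiricalRisk {q d d' N : ℕ} {V : Type*} [NormedAddCommGroup V] [InnerProductSpace ℝ V]
    [RKHS ℝ V (Vec q) (Vec q)] (A : Matrix (Fin q) (Fin d) ℝ) (B : Matrix (Fin d') (Fin q) ℝ)
    (x : Fin N → Vec d) (y : Fin N → Vec d') (v : Control V) : ℝ :=
  1 / (2 * (N : ℝ)) * ∑ i, ‖output A B v (x i) - y i‖ ^ 2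

/-- The data separation `δ = min_{i ≠ j} ‖xⁱ - xʲ‖`. For `N = 1`, where there are no pairs, its
value here is `0`, so that `δ⁻¹ = 0` in accordance with the convention `min ∅ = +∞`. -/
def dataSeparation {d N : ℕ} (x : Fin N → Vec d) : ℝ :=
  sInf {r | ∃ i j, i ≠ j ∧ r = ‖x i - x j‖}

/-! ### The local Polyak-Lojasiewicz property -/

/-- `L : H → [0,∞)` has the local Polyak-Lojasiewicz property with the positive continuous
functions `m, M : [0,∞) → (0,∞)`. -/
def HasLocalPL {H : Type*} [NormedAddCommGroup H] [InnerProductSpace ℝ H] [CompleteSpace H]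
    (L : H → ℝ) (m M : ℝ → ℝ) : Prop :=
  (∀ v, 0 ≤ L v) ∧ Differentiable ℝ L ∧
  ContinuousOn m (Ici 0) ∧ ContinuousOn M (Ici 0) ∧
  (∀ R, 0 ≤ R → 0 < m R) ∧ (∀ R, 0 ≤ R → 0 < M R) ∧
  ∀ v, 2 * m ‖v‖ * L v ≤ ‖gradient L v‖ ^ 2 ∧ ‖gradient L v‖ ^ 2 ≤ 2 * M ‖v‖ * L v

/-- `M(R) = σ_max(Bᵀ)² Λ e^{2κR} / N`. -/
def plUpper {q d' : ℕ} (V : Type*) [NormedAddCommGroup V] [InnerProductSpace ℝ V]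
    [CompleteSpace V] [RKHS ℝ V (Vec q) (Vec q)] (N : ℕ) (κ : ℝ)
    (B : Matrix (Fin d') (Fin q) ℝ) (R : ℝ) : ℝ :=
  1 / (N : ℝ) * sigmaMax B.transpose ^ 2 * bigLambda V N * Real.exp (2 * κ * R)

/-- `m(R) = σ_min(Bᵀ)² λ(σ_min(A)⁻¹ δ⁻¹ e^{κR}) e^{-2κR} / N`. -/
def plLower {q d d' : ℕ} (V : Type*) [NormedAddCommGroup V] [InnerProductSpace ℝ V]
    [CompleteSpace V] [RKHS ℝ V (Vec q) (Vec q)] (N : ℕ) (κ : ℝ)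
    (A : Matrix (Fin q) (Fin d) ℝ) (B : Matrix (Fin d') (Fin q) ℝ) (δ : ℝ) (R : ℝ) : ℝ :=
  1 / (N : ℝ) * sigmaMin B.transpose ^ 2 *
    smallLambda V N ((sigmaMin A)⁻¹ * δ⁻¹ * Real.exp (κ * R)) * Real.exp (-(2 * κ * R))

end FlowResNet

end

open MeasureTheory Set
open scoped ContDiff

noncomputable section

namespace FlowResNet

/-! ### Absolutely continuous functions and Gronwall's inequality -/

/-! The gradient is explicit. Let zⁱ be the trajectory of the i-th data point, rⁱ = F(v, xⁱ) - yⁱ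
its residual, and pⁱ the solution of the adjoint equation along zⁱ with final value Bᵀrⁱ. Then ∇L(v)
is the curve s ↦ (1/N) ∑ᵢ K(·, zⁱ_s) pⁱ_s in `V`. By the reproducing property, its squared norm at
time s is N⁻² times the quadratic form of the kernel matrix of the points zⁱ_s at the block vector
(pⁱ_s) (`inner_kernelMatrix`), so it lies between the extreme eigenvalues times ∑ᵢ ‖pⁱ_s‖².

Gronwall's inequality, in both time directions, controls the two factors. Differences of
trajectories and adjoint states change by at most the factor e^{κ‖v‖} (`IsFlow.norm_sub_le`,
`IsAdjointFlow.norm_le`). The points zⁱ_s therefore stay at distance at least σ_min(A) δ e^{-κ‖v‖},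
and ‖pⁱ_s‖ is comparable to ‖Bᵀrⁱ‖. Since ∑ᵢ ‖rⁱ‖² = 2N L(v), both inequalities hold pointwise in s
and are integrated over [0,1] (`gradient_bounds`).

The gradient formula rests on a first order expansion with a remainder quadratic in the control.
Pairing the adjoint state with the difference of two trajectories and integrating by parts gives it
without a linearised flow (`abs_inner_endpoint_sub_le`). This needs point evaluation to be a C¹
family of operators with a uniform Taylor remainder, which is extracted from the W^{2,∞} bound by
mollification (`exists_taylor_of_isWeakFDeriv`).

Continuity of m amounts to continuity of λ. The smallest eigenvalue is Lipschitz in the points, and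
a configuration with separation δ can be moved slightly to reach a slightly larger separation
(`exists_spread`). -/

theorem absolutelyContinuousOnInterval_of_dist_le {X Y : Type*} [PseudoMetricSpace X]
    [PseudoMetricSpace Y] {f : ℝ → X} {g : ℝ → Y} {a b C : ℝ}
    (hg : AbsolutelyContinuousOnInterval g a b)
    (h : ∀ s ∈ uIcc a b, ∀ t ∈ uIcc a b, dist (f s) (f t) ≤ C * dist (g s) (g t)) :
    AbsolutelyContinuousOnInterval f a b := by
  have hC := Filter.Tendsto.const_mul C hg
  rw [mul_zero] at hC
  refine squeeze_zero' (Filter.Eventually.of_forall fun E =>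
    Finset.sum_nonneg fun i _ => dist_nonneg) ?_ hC
  rw [Filter.eventually_inf_principal]
  filter_upwards with E hE
  rw [Finset.mul_sum]
  exact Finset.sum_le_sum fun i hi => h _ (hE.1 i hi).1 _ (hE.1 i hi).2

theorem absolutelyContinuousOnInterval_comp {f φ : ℝ → ℝ} {a b : ℝ}
    (hφ : ContDiff ℝ 1 φ) (hf : AbsolutelyContinuousOnInterval f a b) :
    AbsolutelyContinuousOnInterval (fun t => φ (f t)) a b := by
  obtain ⟨C, hC⟩ := hf.exists_bound
  have hmem : ∀ t ∈ uIcc a b, f t ∈ Icc (-C) C := fun t ht => abs_le.1 (hC t ht)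
  obtain ⟨K, hK⟩ := (hφ.contDiffOn (s := Icc (-C) C)).exists_lipschitzOnWith (by decide)
    (convex_Icc _ _) isCompact_Icc
  exact absolutelyContinuousOnInterval_of_dist_le (C := K) hf fun s hs t ht =>
    hK.dist_le_mul _ (hmem s hs) _ (hmem t ht)

theorem intervalIntegrable_of_mem {E : Type*} [NormedAddCommGroup E] {f : ℝ → E} {a b s t : ℝ}
    (hf : IntervalIntegrable f volume a b) (hs : s ∈ uIcc a b) (ht : t ∈ uIcc a b) :
    IntervalIntegrable f volume s t :=
  hf.mono_set (uIcc_subset_uIcc hs ht)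

theorem absolutelyContinuousOnInterval_primitive {k : ℝ → ℝ} {a b : ℝ}
    (hk : IntervalIntegrable k volume a b) :
    AbsolutelyContinuousOnInterval (fun t => ∫ s in a..t, k s) a b :=
  hk.absolutelyContinuousOnInterval_intervalIntegral (c := a) (by simp)

/-- The fundamental theorem of calculus for the exponential of a primitive. -/
theorem integral_mul_exp_primitive {k : ℝ → ℝ} {a b : ℝ} (hk : IntervalIntegrable k volume a b)
    (c : ℝ) :
    ∫ t in a..b, c * k t * Real.exp (c * ∫ s in a..t, k s)
      = Real.exp (c * ∫ s in a..b, k s) - 1 := by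
  have hφ : ContDiff ℝ 1 fun x : ℝ => Real.exp (c * x) := by fun_prop
  have hac := absolutelyContinuousOnInterval_comp hφ (absolutelyContinuousOnInterval_primitive hk)
  have h := hac.integral_deriv_eq_sub
  rw [intervalIntegral.integral_same, mul_zero, Real.exp_zero] at h
  rw [← h]
  refine intervalIntegral.integral_congr_ae ?_
  filter_upwards [hk.ae_hasDerivAt_integral] with t ht htm
  rw [(((ht (uIoc_subset_uIcc htm) a left_mem_uIcc).const_mul c).exp).deriv]
  ring

/-- Gronwall's inequality with an integrable coefficient. -/
theorem gronwall_le {k f : ℝ → ℝ} {a b C : ℝ} (hab : a ≤ b)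
    (hk : IntervalIntegrable k volume a b) (hk0 : ∀ s, 0 ≤ k s) (hf : ContinuousOn f (Icc a b))
    (h : ∀ t ∈ Icc a b, f t ≤ C + ∫ s in a..t, k s * f s) :
    f b ≤ C * Real.exp (∫ s in a..b, k s) := by
  have hkf : IntervalIntegrable (fun s => k s * f s) volume a b :=
    hk.mul_continuousOn (by rwa [uIcc_of_le hab])
  have hφ : ContDiff ℝ 1 fun x : ℝ => Real.exp (-x) := by fun_prop
  have hψ : ContDiff ℝ 1 fun x : ℝ => C + x := by fun_prop
  have hac := (absolutelyContinuousOnInterval_comp hψ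
      (absolutelyContinuousOnInterval_primitive hkf)).fun_mul
    (absolutelyContinuousOnInterval_comp hφ (absolutelyContinuousOnInterval_primitive hk))
  have hint := hac.integral_deriv_eq_sub
  -- The product (C + ∫ k f) exp(-∫ k) has a.e. derivative k (f - C - ∫ k f) exp(-∫ k) ≤ 0. Being
  -- absolutely continuous, it cannot exceed its initial value C.
  have hneg : 0 ≤ ∫ t in a..b, -deriv (fun t => (C + ∫ s in a..t, k s * f s) *
      Real.exp (-∫ s in a..t, k s)) t := by
    refine intervalIntegral.integral_nonneg_of_ae_restrict hab ?_
    rw [Filter.EventuallyLE, ae_restrict_iff' measurableSet_Icc]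
    filter_upwards [hk.ae_hasDerivAt_integral, hkf.ae_hasDerivAt_integral] with t h1 h2 ht
    have ht' : t ∈ uIcc a b := by rwa [uIcc_of_le hab]
    have hd := ((h2 ht' a left_mem_uIcc).const_add C).mul
      ((h1 ht' a left_mem_uIcc).neg.exp)
    have hd' := hd.deriv
    simp only [Pi.mul_def, Pi.neg_apply] at hd'
    rw [hd']
    have h3 := h t ht
    have h4 := mul_nonneg (hk0 t) (Real.exp_pos (-∫ s in a..t, k s)).le
    have h5 := mul_nonneg h4 (sub_nonneg.2 h3)
    simp only [Pi.zero_apply]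
    linarith
  rw [intervalIntegral.integral_neg, hint] at hneg
  simp only [intervalIntegral.integral_same, add_zero, neg_zero, Real.exp_zero, mul_one] at hneg
  have h1 : (C + ∫ s in a..b, k s * f s) * Real.exp (-∫ s in a..b, k s) ≤ C := by linarith
  rw [Real.exp_neg, ← div_eq_mul_inv, div_le_iff₀ (Real.exp_pos _)] at h1
  exact (h b (right_mem_Icc.2 hab)).trans h1

/-- Gronwall's inequality backwards in time. -/
theorem gronwall_le_left {k f : ℝ → ℝ} {a b C : ℝ} (hab : a ≤ b)
    (hk : IntervalIntegrable k volume a b) (hk0 : ∀ s, 0 ≤ k s) (hf : ContinuousOn f (Icc a b))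
    (h : ∀ t ∈ Icc a b, f t ≤ C + ∫ s in t..b, k s * f s) :
    f a ≤ C * Real.exp (∫ s in a..b, k s) := by
  have hk' : IntervalIntegrable (fun s => k (-s)) volume (-b) (-a) := by
    have := (IntervalIntegrable.iff_comp_neg (f := k) (a := a) (b := b)).1 hk
    exact this.symm
  have hf' : ContinuousOn (fun s => f (-s)) (Icc (-b) (-a)) :=
    hf.comp continuousOn_neg fun s hs => ⟨by linarith [hs.2], by linarith [hs.1]⟩
  have := gronwall_le (f := fun s => f (-s)) (k := fun s => k (-s)) (C := C)
    (neg_le_neg hab) hk' (fun s => hk0 _) hf' fun t ht => by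
      have h1 := h (-t) ⟨by linarith [ht.2], by linarith [ht.1]⟩
      rwa [intervalIntegral.integral_comp_neg (fun s => k s * f s), neg_neg]
  rwa [intervalIntegral.integral_comp_neg, neg_neg, neg_neg] at this

/-! ### Caratheodory differential equations -/

theorem continuousOn_primitive_uIcc {E : Type*} [NormedAddCommGroup E] [NormedSpace ℝ E]
    {f : ℝ → E} {a b : ℝ} (hf : IntervalIntegrable f volume a b) :
    ContinuousOn (fun t => ∫ s in a..t, f s) (uIcc a b) :=
  intervalIntegral.continuousOn_primitive_interval' hf left_mem_uIcc

/-- Global existence for a Caratheodory differential equation with an integrable Lipschitz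
constant. -/
theorem exists_integral_solution {X : Type*} [NormedAddCommGroup X] [NormedSpace ℝ X]
    [CompleteSpace X] (f : ℝ → X → X) {k : ℝ → ℝ} (hk : IntervalIntegrable k volume 0 1)
    (hk0 : ∀ s, 0 ≤ k s)
    (hfm : ∀ z : ℝ → X, Continuous z → IntervalIntegrable (fun s => f s (z s)) volume 0 1)
    (hlip : ∀ s x y, ‖f s x - f s y‖ ≤ k s * ‖x - y‖) (x₀ : X) :
    ∃ z : ℝ → X, Continuous z ∧ ∀ t ∈ Icc (0 : ℝ) 1, z t = x₀ + ∫ s in (0 : ℝ)..t, f s (z s) := by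
  have h01 : (0 : ℝ) ≤ 1 := zero_le_one
  set K : ℝ → ℝ := fun t => ∫ s in (0 : ℝ)..t, k s with hK
  have hKc : ContinuousOn K (Icc 0 1) := by
    simpa [uIcc_of_le h01] using continuousOn_primitive_uIcc hk
  set K' : C(Icc (0 : ℝ) 1, ℝ) := ⟨fun t => K t, hKc.domRestrict⟩ with hK'
  have hK'a : ∀ t, K' t = K t := fun _ => rfl
  -- The unknown is rescaled as u = exp(-2K) z. In the plain sup norm the Picard map for u contracts
  -- by 1/2 on the whole interval, because ∫ k exp(2K) = (exp(2K) - 1) / 2; no subdivision of [0,1]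
  -- is needed.
  set Z : C(Icc (0 : ℝ) 1, X) → ℝ → X := fun u =>
    IccExtend h01 fun t => Real.exp (2 * K' t) • u t with hZ
  have hZc : ∀ u, Continuous (Z u) := fun u => by
    refine Continuous.Icc_extend' ?_
    fun_prop
  have hZK : ∀ u (t : Icc (0 : ℝ) 1), Z u t = Real.exp (2 * K t) • u t := fun u t => by
    simp [hZ, IccExtend_val, hK'a]
  have hsub : ∀ {t : ℝ}, t ∈ Icc (0 : ℝ) 1 → t ∈ uIcc (0 : ℝ) 1 := fun {t} ht => by
    rwa [uIcc_of_le h01]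
  set S : C(Icc (0 : ℝ) 1, X) → C(Icc (0 : ℝ) 1, X) := fun u =>
    ⟨fun t => Real.exp (-(2 * K' t)) • (x₀ + ∫ s in (0 : ℝ)..t, f s (Z u s)), by
      have h1 : ContinuousOn (fun t => ∫ s in (0 : ℝ)..t, f s (Z u s)) (Icc 0 1) := by
        simpa [uIcc_of_le h01] using continuousOn_primitive_uIcc (hfm _ (hZc u))
      have h2 : Continuous fun t : Icc (0 : ℝ) 1 => ∫ s in (0 : ℝ)..t, f s (Z u s) := h1.domRestrict
      fun_prop⟩ with hS
  have hcontr : ContractingWith (1 / 2 : NNReal) S := by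
    refine ⟨by rw [← NNReal.coe_lt_coe]; norm_num, LipschitzWith.of_dist_le_mul fun u w => ?_⟩
    rw [ContinuousMap.dist_le (by positivity)]
    intro t
    have htm := t.2
    have hkexp : IntervalIntegrable (fun s => k s * Real.exp (2 * K s)) volume 0 t := by
      refine (intervalIntegrable_of_mem hk (by simp) (hsub htm)).mul_continuousOn ?_
      rw [uIcc_of_le htm.1]
      exact ((hKc.mono (Icc_subset_Icc_right htm.2)).const_smul (2 : ℝ)).rexp
    have hint : ∫ s in (0 : ℝ)..t, k s * Real.exp (2 * K s) = (Real.exp (2 * K t) - 1) / 2 := by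
      rw [← integral_mul_exp_primitive (intervalIntegrable_of_mem hk (by simp) (hsub htm)) 2,
        ← intervalIntegral.integral_div]
      congr 1
      ext s
      ring
    have hdiff : ‖∫ s in (0 : ℝ)..t, (f s (Z u s) - f s (Z w s))‖
        ≤ (Real.exp (2 * K t) - 1) / 2 * dist u w := by
      rw [← hint, ← intervalIntegral.integral_mul_const]
      refine intervalIntegral.norm_integral_le_of_norm_le htm.1 ?_ (hkexp.mul_const _)
      refine Filter.Eventually.of_forall fun s hs => ?_
      have hs' : s ∈ Icc (0 : ℝ) 1 := ⟨hs.1.le, hs.2.trans htm.2⟩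
      refine (hlip _ _ _).trans ?_
      rw [hZK u ⟨s, hs'⟩, hZK w ⟨s, hs'⟩, ← smul_sub, norm_smul, Real.norm_eq_abs, Real.abs_exp,
        mul_assoc, ← dist_eq_norm]
      have := hk0 s
      gcongr
      exact ContinuousMap.dist_apply_le_dist _
    have h3 : S u t - S w t
        = Real.exp (-(2 * K t)) • ∫ s in (0 : ℝ)..t, (f s (Z u s) - f s (Z w s)) := by
      rw [intervalIntegral.integral_sub (intervalIntegrable_of_mem (hfm _ (hZc u)) (by simp) (hsub htm))
        (intervalIntegrable_of_mem (hfm _ (hZc w)) (by simp) (hsub htm))]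
      simp [hS, hK'a, ← smul_sub]
    rw [dist_eq_norm, h3, norm_smul, Real.norm_eq_abs, Real.abs_exp]
    calc Real.exp (-(2 * K t)) * ‖∫ s in (0 : ℝ)..t, (f s (Z u s) - f s (Z w s))‖
        ≤ Real.exp (-(2 * K t)) * ((Real.exp (2 * K t) - 1) / 2 * dist u w) := by gcongr
      _ = (1 - Real.exp (-(2 * K t))) / 2 * dist u w := by
          rw [Real.exp_neg]
          field_simp
      _ ≤ ((1 / 2 : NNReal) : ℝ) * dist u w := by
          gcongr
          push_cast
          linarith [Real.exp_pos (-(2 * K t))]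
  obtain ⟨u, hu⟩ : ∃ u, S u = u := ⟨_, hcontr.fixedPoint_isFixedPt⟩
  refine ⟨Z u, hZc u, fun t ht => ?_⟩
  have h4 : S u ⟨t, ht⟩ = u ⟨t, ht⟩ := by rw [hu]
  have h5 : Real.exp (-(2 * K t)) • (x₀ + ∫ s in (0 : ℝ)..t, f s (Z u s)) = u ⟨t, ht⟩ := h4
  have h6 := hZK u ⟨t, ht⟩
  simp only at h6
  rw [h6, ← h5, smul_smul, ← Real.exp_add, add_neg_cancel, Real.exp_zero, one_smul]

/-! ### Primitives of vector-valued functions on the unit interval -/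

instance : IsProbabilityMeasure unitTime := ⟨by simp⟩

theorem intervalIntegrable_iff_integrable_unitTime {E : Type*} [NormedAddCommGroup E]
    {f : ℝ → E} : IntervalIntegrable f volume 0 1 ↔ Integrable f unitTime := by
  rw [intervalIntegrable_iff_integrableOn_Icc_of_le zero_le_one]
  rfl

theorem intervalIntegral_eq_integral_unitTime {E : Type*} [NormedAddCommGroup E]
    [NormedSpace ℝ E] (f : ℝ → E) : ∫ s in (0 : ℝ)..1, f s = ∫ s, f s ∂unitTime := by
  rw [intervalIntegral.integral_of_le zero_le_one, ← integral_Icc_eq_integral_Ioc]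

theorem intervalIntegrable_of_memLp {E : Type*} [NormedAddCommGroup E] {f : ℝ → E}
    (hf : MemLp f 2 unitTime) : IntervalIntegrable f volume 0 1 :=
  intervalIntegrable_iff_integrable_unitTime.2 (hf.integrable one_le_two)

theorem mem_uIcc_zero_one {t : ℝ} (ht : t ∈ Icc (0 : ℝ) 1) : t ∈ uIcc (0 : ℝ) 1 := by
  rwa [uIcc_of_le zero_le_one]

theorem continuousOn_of_eq_primitive {E : Type*} [NormedAddCommGroup E] [NormedSpace ℝ E]
    {u g : ℝ → E} {u₀ : E} (hg : IntervalIntegrable g volume 0 1)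
    (hu : ∀ t ∈ Icc (0 : ℝ) 1, u t = u₀ + ∫ s in (0 : ℝ)..t, g s) :
    ContinuousOn u (Icc 0 1) := by
  have h := continuousOn_primitive_uIcc hg
  rw [uIcc_of_le zero_le_one] at h
  exact (continuousOn_const.add h).congr hu

theorem sub_eq_integral_of_eq_primitive {E : Type*} [NormedAddCommGroup E] [NormedSpace ℝ E]
    {u g : ℝ → E} {u₀ : E} (hg : IntervalIntegrable g volume 0 1)
    (hu : ∀ t ∈ Icc (0 : ℝ) 1, u t = u₀ + ∫ s in (0 : ℝ)..t, g s)
    {s t : ℝ} (hs : s ∈ Icc (0 : ℝ) 1) (ht : t ∈ Icc (0 : ℝ) 1) :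
    u t - u s = ∫ r in s..t, g r := by
  rw [hu t ht, hu s hs, add_sub_add_left_eq_sub, intervalIntegral.integral_interval_sub_left
    (intervalIntegrable_of_mem hg (by simp) (mem_uIcc_zero_one ht))
    (intervalIntegrable_of_mem hg (by simp) (mem_uIcc_zero_one hs))]

theorem norm_sub_le_of_eq_primitive {E : Type*} [NormedAddCommGroup E] [NormedSpace ℝ E]
    {u g : ℝ → E} {u₀ : E} (hg : IntervalIntegrable g volume 0 1)
    (hu : ∀ t ∈ Icc (0 : ℝ) 1, u t = u₀ + ∫ s in (0 : ℝ)..t, g s)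
    {φ : ℝ → ℝ} (hφ : IntervalIntegrable φ volume 0 1) (h : ∀ r ∈ Icc (0 : ℝ) 1, ‖g r‖ ≤ φ r)
    {s t : ℝ} (hs : 0 ≤ s) (hst : s ≤ t) (ht : t ≤ 1) :
    ‖u t - u s‖ ≤ ∫ r in s..t, φ r := by
  have hs' : s ∈ Icc (0 : ℝ) 1 := ⟨hs, hst.trans ht⟩
  have ht' : t ∈ Icc (0 : ℝ) 1 := ⟨hs.trans hst, ht⟩
  rw [sub_eq_integral_of_eq_primitive hg hu hs' ht']
  exact intervalIntegral.norm_integral_le_of_norm_le hst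
    (Filter.Eventually.of_forall fun r hr => h r ⟨hs.trans hr.1.le, hr.2.trans ht⟩)
    (intervalIntegrable_of_mem hφ (mem_uIcc_zero_one hs') (mem_uIcc_zero_one ht'))

theorem intervalIntegral_le_integral_unit {φ : ℝ → ℝ} (hφ : IntervalIntegrable φ volume 0 1)
    (h0 : ∀ r, 0 ≤ φ r) {s t : ℝ} (hs : 0 ≤ s) (hst : s ≤ t) (ht : t ≤ 1) :
    ∫ r in s..t, φ r ≤ ∫ r in (0 : ℝ)..1, φ r :=
  intervalIntegral.integral_mono_interval hs hst ht (Filter.Eventually.of_forall h0) hφ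

/-- A function whose derivative is bounded by `k` times its own size grows and decays at most
by the factor `exp (∫ k)`. -/
theorem norm_le_mul_exp_of_eq_primitive {E : Type*} [NormedAddCommGroup E] [NormedSpace ℝ E]
    {u g : ℝ → E} {u₀ : E} (hg : IntervalIntegrable g volume 0 1)
    (hu : ∀ t ∈ Icc (0 : ℝ) 1, u t = u₀ + ∫ s in (0 : ℝ)..t, g s)
    {k : ℝ → ℝ} (hk : IntervalIntegrable k volume 0 1) (hk0 : ∀ s, 0 ≤ k s)
    (h : ∀ r ∈ Icc (0 : ℝ) 1, ‖g r‖ ≤ k r * ‖u r‖) {K : ℝ} (hK : ∫ r in (0 : ℝ)..1, k r ≤ K)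
    {s t : ℝ} (hs : s ∈ Icc (0 : ℝ) 1) (ht : t ∈ Icc (0 : ℝ) 1) :
    ‖u t‖ ≤ ‖u s‖ * Real.exp K := by
  have hc := continuousOn_of_eq_primitive hg hu
  have hφ : IntervalIntegrable (fun r => k r * ‖u r‖) volume 0 1 :=
    hk.mul_continuousOn (by simpa [uIcc_of_le] using hc.norm)
  have hb := fun {s t : ℝ} => norm_sub_le_of_eq_primitive hg hu hφ h (s := s) (t := t)
  rcases le_total s t with hst | hst
  · have h1 := gronwall_le (f := fun r => ‖u r‖) (C := ‖u s‖) hst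
      (intervalIntegrable_of_mem hk (mem_uIcc_zero_one hs) (mem_uIcc_zero_one ht)) hk0
      (hc.norm.mono (Icc_subset_Icc hs.1 ht.2)) fun r hr => by
        have := hb hs.1 hr.1 (hr.2.trans ht.2)
        linarith [norm_sub_norm_le (u r) (u s)]
    refine h1.trans ?_
    gcongr
    exact (intervalIntegral_le_integral_unit hk hk0 hs.1 hst ht.2).trans hK
  · have h1 := gronwall_le_left (f := fun r => ‖u r‖) (C := ‖u s‖) hst
      (intervalIntegrable_of_mem hk (mem_uIcc_zero_one ht) (mem_uIcc_zero_one hs)) hk0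
      (hc.norm.mono (Icc_subset_Icc ht.1 hs.2)) fun r hr => by
        have := hb (ht.1.trans hr.1) hr.2 hs.2
        linarith [norm_sub_norm_le (u r) (u s), norm_sub_rev (u r) (u s)]
    refine h1.trans ?_
    gcongr
    exact (intervalIntegral_le_integral_unit hk hk0 ht.1 hst hs.2).trans hK

/-- Integration by parts for the inner product of two primitives. -/
theorem inner_sub_inner_eq_integral {X : Type*} [NormedAddCommGroup X] [InnerProductSpace ℝ X]
    [CompleteSpace X] {p w g m : ℝ → X} {p₀ w₀ : X}
    (hg : IntervalIntegrable g volume 0 1) (hm : IntervalIntegrable m volume 0 1)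
    (hp : ∀ t ∈ Icc (0 : ℝ) 1, p t = p₀ + ∫ s in (0 : ℝ)..t, g s)
    (hw : ∀ t ∈ Icc (0 : ℝ) 1, w t = w₀ + ∫ s in (0 : ℝ)..t, m s) :
    inner ℝ (p 1) (w 1) - inner ℝ (p 0) (w 0)
      = ∫ s in (0 : ℝ)..1, (inner ℝ (p s) (m s) + inner ℝ (g s) (w s)) := by
  have hpc := continuousOn_of_eq_primitive hg hp
  have hwc := continuousOn_of_eq_primitive hm hw
  obtain ⟨C, hC⟩ := isCompact_Icc.exists_bound_of_continuousOn hpc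
  obtain ⟨D, hD⟩ := isCompact_Icc.exists_bound_of_continuousOn hwc
  have hsum : IntervalIntegrable (fun s => ‖g s‖ + ‖m s‖) volume 0 1 := hg.norm.add hm.norm
  -- The increments of the scalar function ⟨p, w⟩ are dominated by those of a primitive. This makes
  -- it absolutely continuous, so the scalar fundamental theorem of calculus applies.
  have hest : ∀ s t, 0 ≤ s → s ≤ t → t ≤ 1 →
      dist (inner ℝ (p s) (w s)) (inner ℝ (p t) (w t))
        ≤ (C + D) * ∫ r in s..t, (‖g r‖ + ‖m r‖) := by
    intro s t hs hst ht
    have hs' : s ∈ Icc (0 : ℝ) 1 := ⟨hs, hst.trans ht⟩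
    have ht' : t ∈ Icc (0 : ℝ) 1 := ⟨hs.trans hst, ht⟩
    have h1 := norm_sub_le_of_eq_primitive hg hp hsum
      (fun r _ => le_add_of_nonneg_right (norm_nonneg (m r))) hs hst ht
    have h2 := norm_sub_le_of_eq_primitive hm hw hsum
      (fun r _ => le_add_of_nonneg_left (norm_nonneg (g r))) hs hst ht
    have heq : inner ℝ (p t) (w t) - inner ℝ (p s) (w s)
        = inner ℝ (p t - p s) (w s) + inner ℝ (p t) (w t - w s) := by
      rw [inner_sub_left, inner_sub_right]
      ring
    rw [dist_comm, Real.dist_eq, heq]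
    refine (abs_add_le _ _).trans ?_
    have h3 := abs_real_inner_le_norm (p t - p s) (w s)
    have h4 := abs_real_inner_le_norm (p t) (w t - w s)
    have h5 := mul_le_mul h1 (hD s hs') (norm_nonneg _) ((norm_nonneg _).trans h1)
    have h6 := mul_le_mul (hC t ht') h2 (norm_nonneg _) ((norm_nonneg _).trans (hC t ht'))
    linarith
  have hac : AbsolutelyContinuousOnInterval (fun t => inner ℝ (p t) (w t)) 0 1 := by
    refine absolutelyContinuousOnInterval_of_dist_le (C := C + D)
      (absolutelyContinuousOnInterval_primitive hsum) fun s hs t ht => ?_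
    rw [uIcc_of_le zero_le_one] at hs ht
    have hCD : 0 ≤ C + D :=
      add_nonneg ((norm_nonneg _).trans (hC s hs)) ((norm_nonneg _).trans (hD s hs))
    wlog hst : s ≤ t generalizing s t
    · rw [dist_comm, dist_comm (∫ r in (0 : ℝ)..s, _)]
      exact this t ht s hs (le_of_not_ge hst)
    refine (hest s t hs.1 hst ht.2).trans ?_
    rw [dist_comm, Real.dist_eq, intervalIntegral.integral_interval_sub_left
      (intervalIntegrable_of_mem hsum (by simp) (mem_uIcc_zero_one ht))
      (intervalIntegrable_of_mem hsum (by simp) (mem_uIcc_zero_one hs))]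
    gcongr
    exact le_abs_self _
  rw [← hac.integral_deriv_eq_sub]
  refine intervalIntegral.integral_congr_ae ?_
  -- `p` and `w` are primitives only on [0,1]; discarding t = 1 makes this interval a neighbourhood
  -- of t.
  have h1 : ∀ᵐ t : ℝ, t ≠ 1 := by simp [ae_iff, measure_singleton]
  filter_upwards [hg.ae_hasDerivAt_integral, hm.ae_hasDerivAt_integral, h1] with t h2 h3 h4 ht
  have ht' := uIoc_subset_uIcc ht
  rw [uIoc_of_le zero_le_one] at ht
  have hnhds : Icc (0 : ℝ) 1 ∈ nhds t := Icc_mem_nhds ht.1 (lt_of_le_of_ne ht.2 h4)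
  have hdp : HasDerivAt p (g t) t := ((h2 ht' 0 left_mem_uIcc).const_add p₀).congr_of_eventuallyEq
    (Filter.eventually_of_mem hnhds hp)
  have hdw : HasDerivAt w (m t) t := ((h3 ht' 0 left_mem_uIcc).const_add w₀).congr_of_eventuallyEq
    (Filter.eventually_of_mem hnhds hw)
  exact (hdp.inner ℝ hdw).deriv

/-- Applying a bounded measurable family of operators to a square integrable function. -/
theorem memLp_clm_apply {V Y : Type*} [NormedAddCommGroup V] [NormedSpace ℝ V]
    [NormedAddCommGroup Y] [NormedSpace ℝ Y] {T : ℝ → V →L[ℝ] Y} {v : ℝ → V}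
    (hv : MemLp v 2 unitTime) (hT : AEStronglyMeasurable T unitTime) {C : ℝ}
    (hC : ∀ s ∈ Icc (0 : ℝ) 1, ‖T s‖ ≤ C) : MemLp (fun s => T s (v s)) 2 unitTime := by
  refine MemLp.of_le_mul (c := C) hv ?_ ?_
  · exact (ContinuousLinearMap.id ℝ (V →L[ℝ] Y)).aestronglyMeasurable_comp₂ hT hv.1
  · rw [ae_restrict_iff' measurableSet_Icc]
    refine Filter.Eventually.of_forall fun s hs => ((T s).le_opNorm _).trans ?_
    have := hC s hs
    gcongr

theorem aestronglyMeasurable_comp_continuousOn {X Y : Type*} [TopologicalSpace X]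
    [PseudoMetricSpace Y] {G : X → Y} {z : ℝ → X}
    (hG : Continuous G) (hz : ContinuousOn z (Icc 0 1)) :
    AEStronglyMeasurable (fun s => G (z s)) unitTime :=
  (hG.comp_continuousOn hz).aestronglyMeasurable_of_isCompact isCompact_Icc measurableSet_Icc

/-! ### Flows of square integrable controls -/

/-- `E` is a bounded and Lipschitz family of operators with bounded and continuous derivative `DE`
and a uniform quadratic bound for the Taylor remainder. -/
structure IsSmoothFamily {X V : Type*} [NormedAddCommGroup X] [NormedSpace ℝ X]
    [NormedAddCommGroup V] [NormedSpace ℝ V] (E : X → V →L[ℝ] X) (DE : X → X →L[ℝ] V →L[ℝ] X)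
    (κ : ℝ) : Prop where
  nonneg : 0 ≤ κ
  norm_le : ∀ x, ‖E x‖ ≤ κ
  norm_sub_le : ∀ x y, ‖E x - E y‖ ≤ κ * ‖x - y‖
  norm_deriv_le : ∀ x, ‖DE x‖ ≤ κ
  continuous_deriv : Continuous DE
  norm_taylor_le : ∀ x y, ‖E y - E x - DE x (y - x)‖ ≤ κ * ‖y - x‖ ^ 2

/-- `z` solves `ż_t = E(z_t) v_t`, `z_0 = x₀` on `[0,1]`. -/
def IsFlow {X V : Type*} [NormedAddCommGroup X] [NormedSpace ℝ X]
    [NormedAddCommGroup V] [NormedSpace ℝ V] (E : X → V →L[ℝ] X) (v : ℝ → V) (x₀ : X)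
    (z : ℝ → X) : Prop :=
  MemLp (fun s => E (z s) (v s)) 2 unitTime ∧
    ∀ t ∈ Icc (0 : ℝ) 1, z t = x₀ + ∫ s in (0 : ℝ)..t, E (z s) (v s)

section Flow

variable {X V : Type*} [NormedAddCommGroup X] [NormedSpace ℝ X]
  [NormedAddCommGroup V] [NormedSpace ℝ V] {E : X → V →L[ℝ] X} {DE : X → X →L[ℝ] V →L[ℝ] X}
  {κ : ℝ}

theorem IsSmoothFamily.continuous (hE : IsSmoothFamily E DE κ) : Continuous E :=
  (LipschitzWith.of_dist_le_mul (K := ⟨κ, hE.nonneg⟩) fun x y => by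
    rw [dist_eq_norm, dist_eq_norm]
    exact hE.norm_sub_le x y).continuous

theorem IsFlow.intervalIntegrable {v : ℝ → V} {x₀ : X} {z : ℝ → X} (hz : IsFlow E v x₀ z) :
    IntervalIntegrable (fun s => E (z s) (v s)) volume 0 1 :=
  intervalIntegrable_of_memLp hz.1

theorem IsFlow.continuousOn {v : ℝ → V} {x₀ : X} {z : ℝ → X} (hz : IsFlow E v x₀ z) :
    ContinuousOn z (Icc 0 1) :=
  continuousOn_of_eq_primitive hz.intervalIntegrable hz.2

theorem IsFlow.apply_zero {v : ℝ → V} {x₀ : X} {z : ℝ → X} (hz : IsFlow E v x₀ z) : z 0 = x₀ := by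
  simpa using hz.2 0 (by simp)

theorem intervalIntegrable_const_mul_norm {V : Type*} [NormedAddCommGroup V] {v : ℝ → V} (hv : MemLp v 2 unitTime) (c : ℝ) :
    IntervalIntegrable (fun s => c * ‖v s‖) volume 0 1 :=
  (intervalIntegrable_of_memLp hv).norm.const_mul c

theorem exists_isFlow [CompleteSpace X] (hE : IsSmoothFamily E DE κ) {v : ℝ → V}
    (hv : MemLp v 2 unitTime) (x₀ : X) : ∃ z, IsFlow E v x₀ z := by
  have hmem : ∀ z : ℝ → X, Continuous z → MemLp (fun s => E (z s) (v s)) 2 unitTime :=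
    fun z hz => memLp_clm_apply hv
      (aestronglyMeasurable_comp_continuousOn hE.continuous hz.continuousOn)
      fun s _ => hE.norm_le _
  obtain ⟨z, hz, hsol⟩ := exists_integral_solution (fun s x => E x (v s))
    (intervalIntegrable_const_mul_norm hv κ)
    (fun s => mul_nonneg hE.nonneg (norm_nonneg _))
    (fun z hz => intervalIntegrable_of_memLp (hmem z hz))
    (fun s x y => by
      rw [← sub_apply]
      refine ((E x - E y).le_opNorm _).trans ?_
      have := mul_le_mul_of_nonneg_right (hE.norm_sub_le x y) (norm_nonneg (v s))
      linarith) x₀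
  exact ⟨z, hmem z hz, hsol⟩

/-- The velocity difference is at most κ‖v_s‖ times the distance of the trajectories. The times are
in no fixed order: forwards this gives uniqueness, backwards it keeps trajectories apart. -/
theorem IsFlow.norm_sub_le (hE : IsSmoothFamily E DE κ) {v : ℝ → V} (hv : MemLp v 2 unitTime)
    {R : ℝ} (hR : ∫ s in (0 : ℝ)..1, ‖v s‖ ≤ R) {x₀ y₀ : X} {z w : ℝ → X}
    (hz : IsFlow E v x₀ z) (hw : IsFlow E v y₀ w) {s t : ℝ} (hs : s ∈ Icc (0 : ℝ) 1)
    (ht : t ∈ Icc (0 : ℝ) 1) : ‖z t - w t‖ ≤ ‖z s - w s‖ * Real.exp (κ * R) := by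
  refine norm_le_mul_exp_of_eq_primitive (u := fun t => z t - w t) (u₀ := x₀ - y₀)
    (g := fun s => E (z s) (v s) - E (w s) (v s)) (k := fun s => κ * ‖v s‖)
    (hz.intervalIntegrable.sub hw.intervalIntegrable) (fun t ht => ?_)
    (intervalIntegrable_const_mul_norm hv κ) (fun s => mul_nonneg hE.nonneg (norm_nonneg _))
    (fun r _ => ?_) ?_ hs ht
  · have ht' := mem_uIcc_zero_one ht
    rw [intervalIntegral.integral_sub
      (intervalIntegrable_of_mem hz.intervalIntegrable (by simp) ht')
      (intervalIntegrable_of_mem hw.intervalIntegrable (by simp) ht'), hz.2 t ht, hw.2 t ht]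
    abel
  · rw [← sub_apply]
    refine ((E (z r) - E (w r)).le_opNorm _).trans ?_
    have := mul_le_mul_of_nonneg_right (hE.norm_sub_le (z r) (w r)) (norm_nonneg (v r))
    linarith
  · rw [intervalIntegral.integral_const_mul]
    exact mul_le_mul_of_nonneg_left hR hE.nonneg

theorem IsFlow.eqOn (hE : IsSmoothFamily E DE κ) {v : ℝ → V} (hv : MemLp v 2 unitTime) {x₀ : X}
    {z w : ℝ → X} (hz : IsFlow E v x₀ z) (hw : IsFlow E v x₀ w) : EqOn z w (Icc 0 1) := by
  intro t ht
  have h := IsFlow.norm_sub_le hE hv le_rfl hz hw (s := 0) (by simp) ht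
  rw [hz.apply_zero, hw.apply_zero, sub_self, norm_zero, zero_mul] at h
  exact sub_eq_zero.1 (norm_le_zero_iff.1 h)

/-- Solutions depend in a Lipschitz way on the control. -/
theorem IsFlow.norm_sub_le_of_control (hE : IsSmoothFamily E DE κ) {v v' : ℝ → V}
    (hv : MemLp v 2 unitTime) (hv' : MemLp v' 2 unitTime)
    {R H : ℝ} (hR : ∫ s in (0 : ℝ)..1, ‖v s‖ ≤ R) (hH : ∫ s in (0 : ℝ)..1, ‖v' s - v s‖ ≤ H)
    {x₀ : X} {z z' : ℝ → X} (hz : IsFlow E v x₀ z) (hz' : IsFlow E v' x₀ z')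
    {t : ℝ} (ht : t ∈ Icc (0 : ℝ) 1) : ‖z' t - z t‖ ≤ κ * H * Real.exp (κ * R) := by
  have hκ := hE.nonneg
  have hk := intervalIntegrable_const_mul_norm hv κ
  have hh := intervalIntegrable_const_mul_norm (hv'.sub hv) κ
  have hc : ContinuousOn (fun t => ‖z' t - z t‖) (Icc 0 1) :=
    (hz'.continuousOn.sub hz.continuousOn).norm
  have hkw : IntervalIntegrable (fun s => κ * ‖v s‖ * ‖z' s - z s‖) volume 0 1 :=
    hk.mul_continuousOn (by rwa [uIcc_of_le zero_le_one])
  have hH0 : ∫ s in (0 : ℝ)..1, κ * ‖(v' - v) s‖ ≤ κ * H := by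
    rw [intervalIntegral.integral_const_mul]
    exact mul_le_mul_of_nonneg_left hH hκ
  have hκH : 0 ≤ κ * H := (intervalIntegral.integral_nonneg zero_le_one
    fun s _ => by positivity).trans hH0
  have hg := gronwall_le (f := fun t => ‖z' t - z t‖) (C := κ * H) ht.1
    (intervalIntegrable_of_mem hk (by simp) (mem_uIcc_zero_one ht))
    (fun s => by positivity) (hc.mono (Icc_subset_Icc_right ht.2)) fun r hr => by
      have hr' : r ∈ Icc (0 : ℝ) 1 := ⟨hr.1, hr.2.trans ht.2⟩
      have h1 := norm_sub_le_of_eq_primitive (u := fun t => z' t - z t) (u₀ := 0)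
        (g := fun s => E (z' s) (v' s) - E (z s) (v s))
        (hz'.intervalIntegrable.sub hz.intervalIntegrable)
        (fun t ht => by
          have ht' := mem_uIcc_zero_one ht
          rw [intervalIntegral.integral_sub
            (intervalIntegrable_of_mem hz'.intervalIntegrable (by simp) ht')
            (intervalIntegrable_of_mem hz.intervalIntegrable (by simp) ht'), hz.2 t ht, hz'.2 t ht]
          abel) (hkw.add hh)
        (fun s _ => by
          -- The first term feeds Gronwall's inequality, the second is a source of total size at
          -- most κH.
          have heq : E (z' s) (v' s) - E (z s) (v s)
              = (E (z' s) - E (z s)) (v s) + E (z' s) ((v' - v) s) := by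
            simp only [sub_apply, Pi.sub_apply, map_sub]
            abel
          rw [heq]
          refine (norm_add_le _ _).trans ?_
          have h2 := (E (z' s) - E (z s)).le_of_opNorm_le (hE.norm_sub_le _ _) (v s)
          have h3 := (E (z' s)).le_of_opNorm_le (hE.norm_le _) ((v' - v) s)
          linarith)
        le_rfl hr.1 hr'.2
      rw [hz'.apply_zero, hz.apply_zero, sub_self, sub_zero, intervalIntegral.integral_add
        (intervalIntegrable_of_mem hkw (by simp) (mem_uIcc_zero_one hr'))
        (intervalIntegrable_of_mem hh (by simp) (mem_uIcc_zero_one hr'))] at h1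
      have h4 := intervalIntegral_le_integral_unit hh (fun s => by positivity) le_rfl hr.1 hr'.2
      linarith
  refine hg.trans ?_
  gcongr
  refine (intervalIntegral_le_integral_unit hk (fun s => by positivity) le_rfl ht.1 ht.2).trans ?_
  rw [intervalIntegral.integral_const_mul]
  gcongr

end Flow

/-! ### The adjoint equation -/

theorem intervalIntegrable_clm_apply {X : Type*} [NormedAddCommGroup X] [NormedSpace ℝ X]
    {T : ℝ → X →L[ℝ] X} (hT : IntervalIntegrable T volume 0 1) {y : ℝ → X}
    (hy : ContinuousOn y (Icc 0 1)) : IntervalIntegrable (fun s => T s (y s)) volume 0 1 := by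
  obtain ⟨C, hC⟩ := isCompact_Icc.exists_bound_of_continuousOn hy
  rw [intervalIntegrable_iff_integrable_unitTime] at hT ⊢
  refine (hT.norm.mul_const C).mono' ?_ ?_
  · exact (ContinuousLinearMap.id ℝ (X →L[ℝ] X)).aestronglyMeasurable_comp₂ hT.1
      (hy.aestronglyMeasurable_of_isCompact isCompact_Icc measurableSet_Icc)
  · rw [ae_restrict_iff' measurableSet_Icc]
    refine Filter.Eventually.of_forall fun s hs => ((T s).le_opNorm _).trans ?_
    have := hC s hs
    gcongr

/-- Existence for a linear equation with prescribed final value. -/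
theorem exists_backward_solution {X : Type*} [NormedAddCommGroup X] [NormedSpace ℝ X]
    [CompleteSpace X] {T : ℝ → X →L[ℝ] X} (hT : IntervalIntegrable T volume 0 1) (p₁ : X) :
    ∃ p : ℝ → X, ContinuousOn p (Icc 0 1) ∧
      ∀ t ∈ Icc (0 : ℝ) 1, p t = p₁ + ∫ s in t..1, T s (p s) := by
  have hrev : ∀ {Y : Type _} [NormedAddCommGroup Y] {f : ℝ → Y},
      IntervalIntegrable f volume 0 1 → IntervalIntegrable (fun s => f (1 - s)) volume 0 1 := by
    intro Y _ f hf
    simpa using (hf.comp_sub_left 1).symm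
  have hT' := hrev hT
  obtain ⟨z, hz, hsol⟩ := exists_integral_solution (fun s x => T (1 - s) x) hT'.norm
    (fun s => norm_nonneg _) (fun z hz => intervalIntegrable_clm_apply hT' hz.continuousOn)
    (fun s x y => by rw [← map_sub]; exact (T (1 - s)).le_opNorm _) p₁
  refine ⟨fun t => z (1 - t), by fun_prop, fun t ht => ?_⟩
  dsimp only
  rw [hsol (1 - t) ⟨by linarith [ht.2], by linarith [ht.1]⟩]
  have := intervalIntegral.integral_comp_sub_left (a := t) (b := 1)
    (fun s => T (1 - s) (z s)) 1
  simp only [sub_sub_cancel, sub_self] at this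
  rw [this]

section Adjoint

variable {X V : Type*} [NormedAddCommGroup X] [InnerProductSpace ℝ X] [CompleteSpace X]
  [NormedAddCommGroup V] [NormedSpace ℝ V] {E : X → V →L[ℝ] X} {DE : X → X →L[ℝ] V →L[ℝ] X}
  {κ : ℝ}

/-- The coefficient `(DE(z_t)[·] v_t)^*` of the adjoint equation along a curve `z`. -/
def adjointCoeff (DE : X → X →L[ℝ] V →L[ℝ] X) (v : ℝ → V) (z : ℝ → X) (s : ℝ) : X →L[ℝ] X :=
  ((DE (z s)).flip (v s)).adjoint

theorem inner_adjointCoeff (v : ℝ → V) (z : ℝ → X) (s : ℝ) (p w : X) :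
    inner ℝ (adjointCoeff DE v z s p) w = inner ℝ p (DE (z s) w (v s)) := by
  rw [adjointCoeff, ContinuousLinearMap.adjoint_inner_left, ContinuousLinearMap.flip_apply]

theorem norm_adjointCoeff_le (hE : IsSmoothFamily E DE κ) (v : ℝ → V) (z : ℝ → X) (s : ℝ) :
    ‖adjointCoeff DE v z s‖ ≤ κ * ‖v s‖ := by
  rw [adjointCoeff, LinearIsometryEquiv.norm_map]
  refine (DE (z s)).flip.le_of_opNorm_le ?_ _
  rw [ContinuousLinearMap.opNorm_flip]
  exact hE.norm_deriv_le _

theorem intervalIntegrable_adjointCoeff (hE : IsSmoothFamily E DE κ) {v : ℝ → V}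
    (hv : MemLp v 2 unitTime) {z : ℝ → X} (hz : ContinuousOn z (Icc 0 1)) :
    IntervalIntegrable (adjointCoeff DE v z) volume 0 1 := by
  have h1 : MemLp (fun s => (DE (z s)).flip (v s)) 2 unitTime := by
    refine memLp_clm_apply (T := fun s => (DE (z s)).flip) (C := κ) hv ?_ fun s _ => ?_
    · exact aestronglyMeasurable_comp_continuousOn (G := fun x => (DE x).flip)
        ((ContinuousLinearMap.flipₗᵢ ℝ X V X).continuous.comp hE.continuous_deriv) hz
    · rw [ContinuousLinearMap.opNorm_flip]
      exact hE.norm_deriv_le _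
  rw [intervalIntegrable_iff_integrable_unitTime]
  have h2 := (h1.integrable one_le_two).norm
  refine h2.mono (ContinuousLinearMap.adjoint.continuous.comp_aestronglyMeasurable h1.1) ?_
  refine Filter.Eventually.of_forall fun s => ?_
  rw [adjointCoeff, LinearIsometryEquiv.norm_map, norm_norm]

/-- `p` solves the adjoint equation along `z` with final value `p₁`. -/
def IsAdjointFlow (DE : X → X →L[ℝ] V →L[ℝ] X) (v : ℝ → V) (z : ℝ → X) (p₁ : X)
    (p : ℝ → X) : Prop :=
  ContinuousOn p (Icc 0 1) ∧
    ∀ t ∈ Icc (0 : ℝ) 1, p t = p₁ + ∫ s in t..1, adjointCoeff DE v z s (p s)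

theorem IsAdjointFlow.apply_one {v : ℝ → V} {z : ℝ → X} {p₁ : X} {p : ℝ → X}
    (hp : IsAdjointFlow DE v z p₁ p) : p 1 = p₁ := by
  simpa using hp.2 1 (by simp)

theorem exists_isAdjointFlow (hE : IsSmoothFamily E DE κ) {v : ℝ → V} (hv : MemLp v 2 unitTime)
    {z : ℝ → X} (hz : ContinuousOn z (Icc 0 1)) (p₁ : X) : ∃ p, IsAdjointFlow DE v z p₁ p :=
  exists_backward_solution (intervalIntegrable_adjointCoeff hE hv hz) p₁

theorem IsAdjointFlow.intervalIntegrable (hE : IsSmoothFamily E DE κ) {v : ℝ → V}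
    (hv : MemLp v 2 unitTime) {z : ℝ → X} (hz : ContinuousOn z (Icc 0 1)) {p₁ : X} {p : ℝ → X}
    (hp : IsAdjointFlow DE v z p₁ p) :
    IntervalIntegrable (fun s => adjointCoeff DE v z s (p s)) volume 0 1 :=
  intervalIntegrable_clm_apply (intervalIntegrable_adjointCoeff hE hv hz) hp.1

theorem IsAdjointFlow.eq_primitive (hE : IsSmoothFamily E DE κ) {v : ℝ → V}
    (hv : MemLp v 2 unitTime) {z : ℝ → X} (hz : ContinuousOn z (Icc 0 1)) {p₁ : X} {p : ℝ → X}
    (hp : IsAdjointFlow DE v z p₁ p) {t : ℝ} (ht : t ∈ Icc (0 : ℝ) 1) :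
    p t = p 0 + ∫ s in (0 : ℝ)..t, -adjointCoeff DE v z s (p s) := by
  have hi := hp.intervalIntegrable hE hv hz
  rw [intervalIntegral.integral_neg, hp.2 t ht, hp.2 0 (by simp),
    ← intervalIntegral.integral_add_adjacent_intervals
      (intervalIntegrable_of_mem hi left_mem_uIcc (mem_uIcc_zero_one ht))
      (intervalIntegrable_of_mem hi (mem_uIcc_zero_one ht) right_mem_uIcc)]
  abel

/-- The adjoint coefficient is bounded by κ‖v_s‖. Taking one of the two times to be 1 bounds the
adjoint state by its final value from above or from below. -/
theorem IsAdjointFlow.norm_le (hE : IsSmoothFamily E DE κ) {v : ℝ → V}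
    (hv : MemLp v 2 unitTime) {R : ℝ} (hR : ∫ s in (0 : ℝ)..1, ‖v s‖ ≤ R) {z : ℝ → X}
    (hz : ContinuousOn z (Icc 0 1)) {p₁ : X} {p : ℝ → X} (hp : IsAdjointFlow DE v z p₁ p)
    {s t : ℝ} (hs : s ∈ Icc (0 : ℝ) 1) (ht : t ∈ Icc (0 : ℝ) 1) :
    ‖p t‖ ≤ ‖p s‖ * Real.exp (κ * R) := by
  refine norm_le_mul_exp_of_eq_primitive (hp.intervalIntegrable hE hv hz).neg
    (fun t ht => hp.eq_primitive hE hv hz ht)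
    (intervalIntegrable_const_mul_norm hv κ) (fun s => mul_nonneg hE.nonneg (norm_nonneg _))
    (fun r _ => ?_) ?_ hs ht
  · rw [Pi.neg_apply, norm_neg]
    exact ContinuousLinearMap.le_of_opNorm_le _ (norm_adjointCoeff_le hE v z r) _
  · rw [intervalIntegral.integral_const_mul]
    exact mul_le_mul_of_nonneg_left hR hE.nonneg

/-- First order expansion of the endpoint of the flow in the control, tested against the final
value of a solution of the adjoint equation. -/
theorem abs_inner_endpoint_sub_le (hE : IsSmoothFamily E DE κ) {v v' : ℝ → V}
    (hv : MemLp v 2 unitTime) (hv' : MemLp v' 2 unitTime)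
    {R H : ℝ} (hR : ∫ s in (0 : ℝ)..1, ‖v s‖ ≤ R) (hH : ∫ s in (0 : ℝ)..1, ‖v' s - v s‖ ≤ H)
    {x₀ : X} {z z' : ℝ → X} (hz : IsFlow E v x₀ z) (hz' : IsFlow E v' x₀ z') {p₁ : X}
    {p : ℝ → X} (hp : IsAdjointFlow DE v z p₁ p) :
    |inner ℝ p₁ (z' 1 - z 1) - ∫ s in (0 : ℝ)..1, inner ℝ (p s) (E (z s) (v' s - v s))|
      ≤ ‖p₁‖ * Real.exp (κ * R) * (κ * (κ * Real.exp (κ * R)) ^ 2 * R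
          + κ * (κ * Real.exp (κ * R))) * H ^ 2 := by
  have hκ := hE.nonneg
  set e := Real.exp (κ * R) with he
  have hm : IntervalIntegrable (fun s => E (z' s) (v' s) - E (z s) (v s)) volume 0 1 :=
    hz'.intervalIntegrable.sub hz.intervalIntegrable
  have hpi := hp.intervalIntegrable hE hv hz.continuousOn
  have hw : ∀ t ∈ Icc (0 : ℝ) 1, (fun t => z' t - z t) t
      = 0 + ∫ s in (0 : ℝ)..t, (E (z' s) (v' s) - E (z s) (v s)) := fun t ht => by
    have ht' := mem_uIcc_zero_one ht
    dsimp only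
    rw [intervalIntegral.integral_sub
      (intervalIntegrable_of_mem hz'.intervalIntegrable (by simp) ht')
      (intervalIntegrable_of_mem hz.intervalIntegrable (by simp) ht'), hz.2 t ht, hz'.2 t ht]
    abel
  -- The adjoint equation is paired with the true difference z' - z, not with a linearised flow; its
  -- coefficient will cancel the part of the velocity difference that is linear in z' - z.
  have hparts := inner_sub_inner_eq_integral hpi.neg hm
    (fun t ht => hp.eq_primitive hE hv hz.continuousOn ht) hw
  have hW : ∀ t ∈ Icc (0 : ℝ) 1, ‖z' t - z t‖ ≤ κ * H * e := fun t ht =>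
    IsFlow.norm_sub_le_of_control hE hv hv' hR hH hz hz' ht
  have hP : ∀ t ∈ Icc (0 : ℝ) 1, ‖p t‖ ≤ ‖p₁‖ * e := fun t ht => by
    have := hp.norm_le hE hv hR hz.continuousOn (s := 1) (by simp) ht
    rwa [hp.apply_one] at this
  have hEh : IntervalIntegrable (fun s => E (z s) ((v' - v) s)) volume 0 1 :=
    intervalIntegrable_of_memLp (memLp_clm_apply (hv'.sub hv)
      (aestronglyMeasurable_comp_continuousOn hE.continuous hz.continuousOn)
      fun s _ => hE.norm_le _)
  have hinner : ∀ {y₁ y₂ : ℝ → X}, IntervalIntegrable y₂ volume 0 1 →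
      ContinuousOn y₁ (Icc 0 1) →
      IntervalIntegrable (fun s => inner ℝ (y₁ s) (y₂ s)) volume 0 1 := by
    intro y₁ y₂ h2 h1
    obtain ⟨C, hC⟩ := isCompact_Icc.exists_bound_of_continuousOn h1
    rw [intervalIntegrable_iff_integrable_unitTime] at h2 ⊢
    refine (h2.norm.const_mul C).mono'
      ((h1.aestronglyMeasurable_of_isCompact isCompact_Icc measurableSet_Icc).inner h2.1) ?_
    rw [ae_restrict_iff' measurableSet_Icc]
    refine Filter.Eventually.of_forall fun s hs => (abs_real_inner_le_norm _ _).trans ?_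
    have := hC s hs
    gcongr
  have hI1 := hinner hEh hp.1
  have hI2 := (hinner hm hp.1).add
    ((hinner hpi.neg (hz'.continuousOn.sub hz.continuousOn)).congr (fun s _ =>
      real_inner_comm _ _))
  simp only [hz.apply_zero, hz'.apply_zero, sub_self, inner_zero_right, sub_zero,
    hp.apply_one] at hparts
  -- Only a Taylor remainder, of order ‖z' - z‖², and a mixed term, of order ‖z' - z‖ ‖v' - v‖,
  -- survive. Both are O(H²) because z' - z is O(H).
  have hdiff : inner ℝ p₁ (z' 1 - z 1) - ∫ s in (0 : ℝ)..1, inner ℝ (p s) (E (z s) (v' s - v s))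
      = ∫ s in (0 : ℝ)..1, inner ℝ (p s) ((E (z' s) - E (z s) - DE (z s) (z' s - z s)) (v s)
          + (E (z' s) - E (z s)) (v' s - v s)) := by
    rw [hparts]
    erw [← intervalIntegral.integral_sub hI2 hI1]
    refine intervalIntegral.integral_congr fun s _ => ?_
    simp only [Pi.neg_apply, inner_neg_left, inner_adjointCoeff, sub_apply,
      Pi.sub_apply, map_sub, inner_add_right, inner_sub_right]
    ring
  rw [hdiff, ← Real.norm_eq_abs]
  have hbound : IntervalIntegrable (fun s => ‖p₁‖ * e * (κ * (κ * H * e) ^ 2 * ‖v s‖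
      + κ * (κ * H * e) * ‖v' s - v s‖)) volume 0 1 :=
    ((intervalIntegrable_const_mul_norm hv _).add
      (intervalIntegrable_const_mul_norm (hv'.sub hv) _)).const_mul _
  have hH0 : 0 ≤ H := (intervalIntegral.integral_nonneg zero_le_one
    fun s _ => norm_nonneg _).trans hH
  have he0 : 0 ≤ e := (Real.exp_pos _).le
  refine (intervalIntegral.norm_integral_le_of_norm_le zero_le_one
    (Filter.Eventually.of_forall fun s hs => ?_) hbound).trans ?_
  · have hs' : s ∈ Icc (0 : ℝ) 1 := ⟨hs.1.le, hs.2⟩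
    refine (abs_real_inner_le_norm _ _).trans ?_
    refine mul_le_mul (hP s hs') ((norm_add_le _ _).trans (add_le_add ?_ ?_)) (norm_nonneg _)
      (by positivity)
    · refine ContinuousLinearMap.le_of_opNorm_le _ ((hE.norm_taylor_le _ _).trans ?_) _
      have := hW s hs'
      gcongr
    · refine ContinuousLinearMap.le_of_opNorm_le _ ((hE.norm_sub_le _ _).trans ?_) _
      have := hW s hs'
      gcongr
  · have hadd := intervalIntegral.integral_add
      (intervalIntegrable_const_mul_norm hv (κ * (κ * H * e) ^ 2))
      (intervalIntegrable_const_mul_norm (hv'.sub hv) (κ * (κ * H * e)))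
    simp only [Pi.sub_apply] at hadd
    rw [intervalIntegral.integral_const_mul, hadd, intervalIntegral.integral_const_mul,
      intervalIntegral.integral_const_mul]
    calc ‖p₁‖ * e * (κ * (κ * H * e) ^ 2 * (∫ s in (0 : ℝ)..1, ‖v s‖)
          + κ * (κ * H * e) * ∫ s in (0 : ℝ)..1, ‖v' s - v s‖)
        ≤ ‖p₁‖ * e * (κ * (κ * H * e) ^ 2 * R + κ * (κ * H * e) * H) := by gcongr
      _ = _ := by ring

end Adjoint

/-! ### Functions with bounded weak derivatives -/

section WeakDerivative

open scoped Convolution Topology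

variable {q : ℕ} {F : Type*} [NormedAddCommGroup F] [NormedSpace ℝ F]

/-- The mollification of `f` by the bump function `φ`. -/
def mollify (φ : ContDiffBump (0 : Vec q)) (f : Vec q → F) : Vec q → F :=
  φ.normed volume ⋆[ContinuousLinearMap.lsmul ℝ ℝ, volume] f

theorem mollify_apply (φ : ContDiffBump (0 : Vec q)) (f : Vec q → F) (x : Vec q) :
    mollify φ f x = ∫ t, φ.normed volume (x - t) • f t := by
  rw [mollify, convolution_eq_swap]
  rfl

theorem integrable_mollify (φ : ContDiffBump (0 : Vec q)) {f : Vec q → F}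
    (hf : LocallyIntegrable f volume) (x : Vec q) :
    Integrable (fun t => φ.normed volume (x - t) • f t) volume := by
  have h := (φ.hasCompactSupport_normed (μ := volume)).convolutionExists_left
    (ContinuousLinearMap.lsmul ℝ ℝ) φ.continuous_normed hf x
  exact (convolutionExistsAt_iff_integrable_swap.1 h)

theorem norm_mollify_le (φ : ContDiffBump (0 : Vec q)) {f : Vec q → F} {C : ℝ}
    (hC : ∀ᵐ t, ‖f t‖ ≤ C) (x : Vec q) : ‖mollify φ f x‖ ≤ C := by
  have hint : Integrable (fun t => φ.normed volume (x - t)) (volume : Measure (Vec q)) :=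
    (φ.integrable_normed).comp_sub_left x
  have hone : ∫ t, φ.normed volume (x - t) = 1 := by
    rw [integral_sub_left_eq_self (fun t => φ.normed volume t) volume x, φ.integral_normed]
  rw [mollify_apply]
  refine (norm_integral_le_of_norm_le (hint.mul_const C) ?_).trans ?_
  · filter_upwards [hC] with t ht
    rw [norm_smul, Real.norm_of_nonneg (φ.nonneg_normed _)]
    exact mul_le_mul_of_nonneg_left ht (φ.nonneg_normed _)
  · rw [integral_mul_const, hone, one_mul]

/-- Mollification commutes with weak derivatives. -/
theorem hasFDerivAt_mollify [CompleteSpace F] (φ : ContDiffBump (0 : Vec q)) {f : Vec q → F}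
    {g : Vec q → Vec q →L[ℝ] F} (h : IsWeakFDeriv f g) (x : Vec q) :
    HasFDerivAt (mollify φ f) (mollify φ g x) x := by
  obtain ⟨hf, hg, hfg⟩ := h
  set ψ : Vec q → ℝ := φ.normed volume with hψ
  have hψc : HasCompactSupport ψ := φ.hasCompactSupport_normed
  have hψd : ContDiff ℝ ∞ ψ := φ.contDiff_normed
  have hd := hψc.hasFDerivAt_convolution_left (ContinuousLinearMap.lsmul ℝ ℝ)
    (hψd.of_le (by simp)) hf x (μ := volume)
  refine hd.congr_fderiv ?_
  ext1 e
  have hex := (hψc.fderiv ℝ).convolutionExists_left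
    (ContinuousLinearMap.precompL (Vec q) (ContinuousLinearMap.lsmul ℝ ℝ : ℝ →L[ℝ] F →L[ℝ] F))
    (hψd.continuous_fderiv (by simp)) hf x (μ := volume)
  rw [convolution_eq_swap, mollify_apply,
    ContinuousLinearMap.integral_apply (convolutionExistsAt_iff_integrable_swap.1 hex),
    ContinuousLinearMap.integral_apply (integrable_mollify φ hg x)]
  have hθc : HasCompactSupport fun t => ψ (x - t) :=
    hψc.comp_homeomorph (Homeomorph.subLeft x)
  have hθd : ContDiff ℝ ∞ fun t => ψ (x - t) := hψd.comp (contDiff_const.sub contDiff_id)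
  -- The test function is t ↦ ψ(x - t); the sign from its chain rule cancels the sign in the
  -- definition of the weak derivative.
  have hweak := hfg _ hθd hθc e
  have hder : ∀ t, fderiv ℝ (fun t => ψ (x - t)) t e = -(fderiv ℝ ψ (x - t) e) := by
    intro t
    have h1 : HasFDerivAt ψ (fderiv ℝ ψ (x - t)) (x - t) :=
      (hψd.differentiable (by simp) _).hasFDerivAt
    have h2 : HasFDerivAt (fun t => ψ (x - t)) _ t :=
      h1.comp t ((hasFDerivAt_id t).const_sub x)
    rw [h2.fderiv]
    simp
  simp only [hder, neg_smul, integral_neg, neg_inj] at hweak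
  simpa using hweak

theorem norm_sub_le_of_hasFDerivAt {E : Type*} [NormedAddCommGroup E] [NormedSpace ℝ E]
    {f : E → F} {f' : E → E →L[ℝ] F} (hf : ∀ x, HasFDerivAt f (f' x) x) {C : ℝ}
    (hC : ∀ x, ‖f' x‖ ≤ C) (x y : E) : ‖f y - f x‖ ≤ C * ‖y - x‖ :=
  convex_univ.norm_image_sub_le_of_norm_hasFDerivWithin_le
    (fun x _ => (hf x).hasFDerivWithinAt) (fun x _ => hC x) (mem_univ x) (mem_univ y)

theorem norm_taylor_le_of_hasFDerivAt {E : Type*} [NormedAddCommGroup E] [NormedSpace ℝ E]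
    {f : E → F} {f' : E → E →L[ℝ] F} {C : ℝ} (hC : 0 ≤ C) (hf : ∀ x, HasFDerivAt f (f' x) x)
    (hf' : ∀ x y, ‖f' y - f' x‖ ≤ C * ‖y - x‖) (x y : E) :
    ‖f y - f x - f' x (y - x)‖ ≤ C * ‖y - x‖ ^ 2 := by
  have h := (convex_closedBall x ‖y - x‖).norm_image_sub_le_of_norm_hasFDerivWithin_le'
    (φ := f' x) (C := C * ‖y - x‖) (x := x) (y := y) (fun w _ => (hf w).hasFDerivWithinAt)
    (fun w hw => (hf' x w).trans (by
      rw [mem_closedBall_iff_norm] at hw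
      gcongr)) (by simp) (by simp [dist_eq_norm])
  rwa [mul_assoc, ← sq] at h

/-- A continuous function with bounded first and second weak derivatives is differentiable, with a
quadratic Taylor remainder. -/
theorem exists_taylor_of_isWeakFDeriv [FiniteDimensional ℝ F] {f : Vec q → F}
    {g : Vec q → Vec q →L[ℝ] F} {h : Vec q → Vec q →L[ℝ] Vec q →L[ℝ] F} (hf : Continuous f)
    (hfg : IsWeakFDeriv f g) (hgh : IsWeakFDeriv g h) {C₁ C₂ : ℝ}
    (h₁ : ∀ᵐ t, ‖g t‖ ≤ C₁) (h₂ : ∀ᵐ t, ‖h t‖ ≤ C₂) (x : Vec q) :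
    ∃ G : Vec q →L[ℝ] F, ‖G‖ ≤ C₁ ∧ ∀ y, ‖f y - f x - G (y - x)‖ ≤ C₂ * ‖y - x‖ ^ 2 := by
  have hC₂ : 0 ≤ C₂ := by
    obtain ⟨t, ht⟩ := h₂.exists
    exact (norm_nonneg (h t)).trans ht
  let φ : ℕ → ContDiffBump (0 : Vec q) := fun n =>
    ⟨1 / (2 * ((n : ℝ) + 1)), 1 / ((n : ℝ) + 1), by positivity, by
      rw [div_lt_div_iff₀ (by positivity) (by positivity)]
      have : (0 : ℝ) ≤ n := Nat.cast_nonneg n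
      linarith⟩
  have hφ : Filter.Tendsto (fun n => (φ n).rOut) Filter.atTop (𝓝 0) :=
    tendsto_one_div_add_atTop_nhds_zero_nat
  have hlim : ∀ y, Filter.Tendsto (fun n => mollify (φ n) f y) Filter.atTop (𝓝 (f y)) := fun y =>
    ContDiffBump.convolution_tendsto_right_of_continuous hφ hf y
  have htaylor : ∀ n y, ‖mollify (φ n) f y - mollify (φ n) f x - mollify (φ n) g x (y - x)‖
      ≤ C₂ * ‖y - x‖ ^ 2 := fun n y =>
    norm_taylor_le_of_hasFDerivAt hC₂ (hasFDerivAt_mollify (φ n) hfg)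
      (fun a b => norm_sub_le_of_hasFDerivAt (hasFDerivAt_mollify (φ n) hgh)
        (norm_mollify_le (φ n) h₂) a b) x y
  have : ProperSpace (Vec q →L[ℝ] F) := FiniteDimensional.proper_real _
  -- The derivatives of the mollifications at x stay in a compact ball, and the Taylor bound is
  -- uniform in n. It therefore passes to the limit along a subsequence, with the cluster point as
  -- derivative.
  obtain ⟨G, hG, s, hs, hGs⟩ := (isCompact_closedBall (0 : Vec q →L[ℝ] F) C₁).tendsto_subseq
    (x := fun n => mollify (φ n) g x) fun n => by
      simpa using norm_mollify_le (φ n) h₁ x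
  refine ⟨G, by simpa using hG, fun y => ?_⟩
  have hl := (((hlim y).comp hs.tendsto_atTop).sub ((hlim x).comp hs.tendsto_atTop)).sub
    (((ContinuousLinearMap.apply ℝ F (y - x)).continuous.tendsto G).comp hGs)
  exact le_of_tendsto hl.norm (Filter.Eventually.of_forall fun n => htaylor (s n) y)

/-- A conull set is dense, and this one is closed by continuity. -/
theorem norm_le_of_ae_norm_le {F : Type*} [NormedAddCommGroup F] {f : Vec q → F} (hf : Continuous f) {C : ℝ}
    (hC : ∀ᵐ t, ‖f t‖ ≤ C) (x : Vec q) : ‖f x‖ ≤ C := by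
  have hcl : IsClosed {t | ‖f t‖ ≤ C} := isClosed_le hf.norm continuous_const
  have hd : Dense {t | ‖f t‖ ≤ C} := Measure.dense_of_ae hC
  have := hd.closure_eq
  rw [hcl.closure_eq] at this
  exact this.symm.subset (mem_univ x)

theorem ae_norm_le_toReal {F : Type*} [NormedAddCommGroup F] {α : Type*} [MeasurableSpace α] {μ : Measure α} {f : α → F}
    (h : eLpNorm f ⊤ μ ≠ ⊤) : ∀ᵐ t ∂μ, ‖f t‖ ≤ (eLpNorm f ⊤ μ).toReal := by
  rw [eLpNorm_exponent_top] at h ⊢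
  filter_upwards [ae_le_eLpNormEssSup (f := f) (μ := μ)] with t ht
  rw [← toReal_enorm]
  exact ENNReal.toReal_mono h ht

end WeakDerivative

/-! ### Derivatives from quadratic Taylor bounds -/

theorem hasFDerivAt_of_norm_taylor_le {E F : Type*} [NormedAddCommGroup E] [NormedSpace ℝ E]
    [NormedAddCommGroup F] [NormedSpace ℝ F] {f : E → F} {G : E →L[ℝ] F} {x : E} {C : ℝ}
    (h : ∀ y, ‖f y - f x - G (y - x)‖ ≤ C * ‖y - x‖ ^ 2) : HasFDerivAt f G x := by
  have h0 : HasFDerivAt (fun y => f y - f x - G (y - x)) (0 : E →L[ℝ] F) x := by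
    refine Asymptotics.IsBigO.hasFDerivAt (n := 2) ?_ one_lt_two
    refine Asymptotics.IsBigO.of_bound C (Filter.Eventually.of_forall fun y => ?_)
    simpa using h y
  have h1 := (h0.add (G.hasFDerivAt.comp x ((hasFDerivAt_id x).sub_const x))).add_const (f x)
  refine (h1.congr_fderiv (by simp)).congr_of_eventuallyEq
    (Filter.Eventually.of_forall fun y => ?_)
  simp

/-- A uniform quadratic bound for the Taylor remainder makes the derivative Lipschitz. -/
theorem norm_deriv_sub_le_of_norm_taylor_le {E F : Type*} [NormedAddCommGroup E]
    [NormedSpace ℝ E] [NormedAddCommGroup F] [NormedSpace ℝ F] {f : E → F} {G : E → E →L[ℝ] F}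
    {C : ℝ} (hC : 0 ≤ C) (h : ∀ x y, ‖f y - f x - G x (y - x)‖ ≤ C * ‖y - x‖ ^ 2) (x y : E) :
    ‖G y - G x‖ ≤ 6 * C * ‖y - x‖ := by
  set r := ‖y - x‖ with hr
  rcases (norm_nonneg (y - x)).eq_or_lt with h0 | h0
  · rw [sub_eq_zero.1 (norm_eq_zero.1 h0.symm)]
    simp only [sub_self, norm_zero]
    positivity
  refine ContinuousLinearMap.opNorm_le_of_unit_norm (by positivity) fun k hk => ?_
  have hrk : ‖r • k‖ = r := by rw [norm_smul, hk, mul_one, norm_norm]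
  have h1 := h y (y + r • k)
  have h2 := h x (y + r • k)
  have h3 := h x y
  rw [add_sub_cancel_left, hrk] at h1
  have h4 : ‖y + r • k - x‖ ≤ 2 * r := by
    rw [add_sub_right_comm]
    refine (norm_add_le _ _).trans ?_
    rw [hrk]
    linarith
  have h5 : ‖f (y + r • k) - f x - G x (y + r • k - x)‖ ≤ C * (2 * r) ^ 2 :=
    h2.trans (by gcongr)
  -- Three expansions on the triangle x, y, y + r k are compared. With step length r = ‖y - x‖ their
  -- remainders are at most 4Cr², Cr² and Cr², whence the constant 6.
  have heq : r • (G y - G x) k = (f (y + r • k) - f x - G x (y + r • k - x))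
      - (f y - f x - G x (y - x)) - (f (y + r • k) - f y - G y (r • k)) := by
    rw [add_sub_right_comm, map_add, ← map_smul, sub_apply]
    abel
  have h6 : r * ‖(G y - G x) k‖ ≤ r * (6 * C * r) := by
    rw [← norm_smul_of_nonneg h0.le, heq]
    refine (norm_sub_le _ _).trans ((add_le_add_left (norm_sub_le _ _) _).trans ?_)
    linarith
  exact le_of_mul_le_mul_left h6 h0

theorem toReal_add_add_le {a b c : ENNReal} {r : ℝ} (hr : 0 ≤ r)
    (h : a + b + c ≤ ENNReal.ofReal r) :
    a ≠ ⊤ ∧ b ≠ ⊤ ∧ c ≠ ⊤ ∧ a.toReal + b.toReal + c.toReal ≤ r := by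
  obtain ⟨h1, hc⟩ := ENNReal.add_lt_top.1 (h.trans_lt ENNReal.ofReal_lt_top)
  obtain ⟨ha, hb⟩ := ENNReal.add_lt_top.1 h1
  refine ⟨ha.ne, hb.ne, hc.ne, ?_⟩
  rw [← ENNReal.toReal_add ha.ne hb.ne, ← ENNReal.toReal_add h1.ne hc.ne]
  exact ENNReal.toReal_le_of_le_ofReal hr h

/-! ### Point evaluations of a strongly admissible space -/

section Admissible

variable {q : ℕ} (V : Type*) [NormedAddCommGroup V] [InnerProductSpace ℝ V]
  [RKHS ℝ V (Vec q) (Vec q)]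

/-- Point evaluation at `x`. -/
def evalCLM (x : Vec q) : V →L[ℝ] Vec q :=
  ContinuousLinearMap.proj x ∘L RKHS.coeCLM ℝ

variable {V}

/-- Replaces essential suprema by bounds at every point. Apart from κ > 0, admissibility enters the
later arguments only through this. As the constants are nonnegative, each of them is at most κ‖v‖.
-/
theorem IsStronglyAdmissible.exists_bounds {κ : ℝ} (hV : IsStronglyAdmissible V κ) (v : V) :
    ∃ C₀ C₁ C₂ : ℝ, 0 ≤ C₀ ∧ 0 ≤ C₁ ∧ 0 ≤ C₂ ∧ C₀ + C₁ + C₂ ≤ κ * ‖v‖ ∧ (∀ x, ‖v x‖ ≤ C₀) ∧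
      ∀ x, ∃ G : Vec q →L[ℝ] Vec q, ‖G‖ ≤ C₁ ∧
        ∀ y, ‖v y - v x - G (y - x)‖ ≤ C₂ * ‖y - x‖ ^ 2 := by
  obtain ⟨hκ, hV⟩ := hV
  obtain ⟨hc, Dv, D2v, h1, h2, hle⟩ := hV v
  obtain ⟨h0t, h1t, h2t, hsum⟩ := toReal_add_add_le (mul_nonneg hκ.le (norm_nonneg v)) hle
  have hb0 := norm_le_of_ae_norm_le hc (ae_norm_le_toReal h0t)
  have hb1 := ae_norm_le_toReal h1t
  have hb2 : ∀ᵐ t, ‖D2v t‖ ≤ (eLpNorm D2v ⊤ volume).toReal :=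
    ae_norm_le_toReal (F := Vec q →L[ℝ] Vec q →L[ℝ] Vec q) h2t
  have hT := exists_taylor_of_isWeakFDeriv hc h1 h2 hb1 hb2
  exact ⟨_, _, _, ENNReal.toReal_nonneg, ENNReal.toReal_nonneg, ENNReal.toReal_nonneg,
    hsum, hb0, hT⟩

theorem IsStronglyAdmissible.norm_taylor_le {κ : ℝ} (hV : IsStronglyAdmissible V κ) (v : V)
    (x y : Vec q) :
    ‖v y - v x - fderiv ℝ (v : Vec q → Vec q) x (y - x)‖ ≤ κ * ‖v‖ * ‖y - x‖ ^ 2 := by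
  obtain ⟨C₀, C₁, C₂, h0, h1, h2, hle, -, hG⟩ := hV.exists_bounds v
  obtain ⟨G, -, hG⟩ := hG x
  rw [(hasFDerivAt_of_norm_taylor_le hG).fderiv]
  refine (hG y).trans ?_
  gcongr
  linarith

theorem IsStronglyAdmissible.hasFDerivAt {κ : ℝ} (hV : IsStronglyAdmissible V κ) (v : V)
    (x : Vec q) : HasFDerivAt (v : Vec q → Vec q) (fderiv ℝ (v : Vec q → Vec q) x) x :=
  hasFDerivAt_of_norm_taylor_le (hV.norm_taylor_le v x)

theorem IsStronglyAdmissible.norm_fderiv_le {κ : ℝ} (hV : IsStronglyAdmissible V κ) (v : V)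
    (x : Vec q) : ‖fderiv ℝ (v : Vec q → Vec q) x‖ ≤ κ * ‖v‖ := by
  obtain ⟨C₀, C₁, C₂, h0, h1, h2, hle, -, hG⟩ := hV.exists_bounds v
  obtain ⟨G, hG1, hG⟩ := hG x
  rw [(hasFDerivAt_of_norm_taylor_le hG).fderiv]
  linarith

theorem IsStronglyAdmissible.norm_apply_le {κ : ℝ} (hV : IsStronglyAdmissible V κ) (v : V)
    (x : Vec q) : ‖v x‖ ≤ κ * ‖v‖ := by
  obtain ⟨C₀, C₁, C₂, h0, h1, h2, hle, hb, -⟩ := hV.exists_bounds v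
  linarith [hb x]

/-- The derivative of the point evaluations with respect to the point. -/
def derivEvalCLM {κ : ℝ} (hV : IsStronglyAdmissible V κ) (x : Vec q) :
    Vec q →L[ℝ] V →L[ℝ] Vec q :=
  (LinearMap.mkContinuous
    { toFun := fun v : V => fderiv ℝ (v : Vec q → Vec q) x
      map_add' := fun v w => by
        rw [RKHS.coe_add]
        exact ((hV.hasFDerivAt v x).add (hV.hasFDerivAt w x)).fderiv
      map_smul' := fun c v => by
        rw [RKHS.coe_smul]
        exact ((hV.hasFDerivAt v x).const_smul c).fderiv } κ
    fun v => hV.norm_fderiv_le v x).flip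

/-- The velocity v_t(z_t) is E(z_t) v_t with E(x) the evaluation at x, so bounds on single fields,
being linear in ‖v‖, become operator norm bounds. Continuity of the derivative follows from the
uniform Taylor remainder, which makes it 6κ-Lipschitz. -/
theorem IsStronglyAdmissible.isSmoothFamily {κ : ℝ} (hV : IsStronglyAdmissible V κ) :
    IsSmoothFamily (evalCLM V) (derivEvalCLM hV) κ := by
  have hκ : 0 ≤ κ := hV.1.le
  have htaylor : ∀ x y, ‖evalCLM V y - evalCLM V x - derivEvalCLM hV x (y - x)‖
      ≤ κ * ‖y - x‖ ^ 2 := fun x y =>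
    ContinuousLinearMap.opNorm_le_bound _ (by positivity) fun v =>
      (hV.norm_taylor_le v x y).trans_eq (by ring)
  refine ⟨hκ, fun x => ?_, fun x y => ?_, fun x => ?_, ?_, htaylor⟩
  · exact ContinuousLinearMap.opNorm_le_bound _ hκ fun v => hV.norm_apply_le v x
  · refine ContinuousLinearMap.opNorm_le_bound _ (by positivity) fun v => ?_
    have := norm_sub_le_of_hasFDerivAt (hV.hasFDerivAt v) (hV.norm_fderiv_le v) y x
    exact this.trans_eq (by ring)
  · refine (ContinuousLinearMap.opNorm_flip _).trans_le ?_
    exact LinearMap.mkContinuous_norm_le _ hκ _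
  · have hL : LipschitzWith ⟨6 * κ, by positivity⟩ (derivEvalCLM hV) :=
      LipschitzWith.of_dist_le_mul fun y x => by
        rw [dist_eq_norm, dist_eq_norm]
        exact norm_deriv_sub_le_of_norm_taylor_le hκ htaylor x y
    exact hL.continuous

end Admissible

/-! ### Extreme eigenvalues and singular values -/

section Rayleigh

variable {E ι : Type*} [NormedAddCommGroup E] [InnerProductSpace ℝ E] [Fintype ι]

theorem inner_apply_self_eq_sum {T : E →ₗ[ℝ] E} (hT : T.IsSymmetric)
    (b : OrthonormalBasis ι ℝ E) {μ : ι → ℝ} (hb : ∀ i, T (b i) = μ i • b i) (u : E) :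
    inner ℝ (T u) u = ∑ i, μ i * inner ℝ (b i) u ^ 2 := by
  rw [← b.sum_inner_mul_inner]
  refine Finset.sum_congr rfl fun i _ => ?_
  rw [hT, hb, inner_smul_right, real_inner_comm]
  ring

theorem norm_sq_eq_sum_inner_sq (b : OrthonormalBasis ι ℝ E) (u : E) :
    ‖u‖ ^ 2 = ∑ i, inner ℝ (b i) u ^ 2 := by
  rw [← real_inner_self_eq_norm_sq, ← b.sum_inner_mul_inner]
  refine Finset.sum_congr rfl fun i _ => ?_
  rw [real_inner_comm, sq]

theorem mul_norm_sq_le_inner_apply_self {T : E →ₗ[ℝ] E} (hT : T.IsSymmetric)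
    (b : OrthonormalBasis ι ℝ E) {μ : ι → ℝ} (hb : ∀ i, T (b i) = μ i • b i) {m : ℝ}
    (hm : ∀ i, m ≤ μ i) (u : E) : m * ‖u‖ ^ 2 ≤ inner ℝ (T u) u := by
  rw [inner_apply_self_eq_sum hT b hb, norm_sq_eq_sum_inner_sq b, Finset.mul_sum]
  exact Finset.sum_le_sum fun i _ => mul_le_mul_of_nonneg_right (hm i) (sq_nonneg _)

theorem inner_apply_self_le_mul_norm_sq {T : E →ₗ[ℝ] E} (hT : T.IsSymmetric)
    (b : OrthonormalBasis ι ℝ E) {μ : ι → ℝ} (hb : ∀ i, T (b i) = μ i • b i) {m : ℝ}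
    (hm : ∀ i, μ i ≤ m) (u : E) : inner ℝ (T u) u ≤ m * ‖u‖ ^ 2 := by
  rw [inner_apply_self_eq_sum hT b hb, norm_sq_eq_sum_inner_sq b, Finset.mul_sum]
  exact Finset.sum_le_sum fun i _ => mul_le_mul_of_nonneg_right (hm i) (sq_nonneg _)

end Rayleigh

section SingularValues

variable {E F : Type*} [NormedAddCommGroup E] [InnerProductSpace ℝ E] [FiniteDimensional ℝ E]
  [NormedAddCommGroup F] [InnerProductSpace ℝ F] [FiniteDimensional ℝ F]

theorem inner_adjoint_comp_self (T : E →ₗ[ℝ] F) (u : E) :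
    inner ℝ ((T.adjoint ∘ₗ T) u) u = ‖T u‖ ^ 2 := by
  rw [LinearMap.comp_apply, LinearMap.adjoint_inner_left, real_inner_self_eq_norm_sq]

/-- The squared singular values are the eigenvalues of T*T, and index n - 1 carries the smallest.
For n = 0 there is no eigenvalue to compare. -/
theorem singularValues_mul_norm_le (T : E →ₗ[ℝ] F) {n : ℕ} (hn : Module.finrank ℝ E = n) (u : E) :
    T.singularValues (n - 1) * ‖u‖ ≤ ‖T u‖ := by
  have h := mul_norm_sq_le_inner_apply_self T.isSymmetric_adjoint_comp_self
    (T.isSymmetric_adjoint_comp_self.eigenvectorBasis hn)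
    (T.isSymmetric_adjoint_comp_self.apply_eigenvectorBasis hn)
    (m := T.singularValues (n - 1) ^ 2) (fun i => by
      rw [RCLike.ofReal_real_eq_id, id, ← T.sq_singularValues_fin hn]
      exact pow_le_pow_left₀ (T.singularValues_nonneg _)
        (T.singularValues_antitone (Nat.le_sub_one_of_lt i.2)) 2) u
  rw [inner_adjoint_comp_self, ← mul_pow] at h
  exact le_of_sq_le_sq h (norm_nonneg _)

theorem norm_apply_le_singularValues (T : E →ₗ[ℝ] F) (u : E) :
    ‖T u‖ ≤ T.singularValues 0 * ‖u‖ := by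
  have h := inner_apply_self_le_mul_norm_sq T.isSymmetric_adjoint_comp_self
    (T.isSymmetric_adjoint_comp_self.eigenvectorBasis rfl)
    (T.isSymmetric_adjoint_comp_self.apply_eigenvectorBasis rfl)
    (m := T.singularValues 0 ^ 2) (fun i => by
      rw [RCLike.ofReal_real_eq_id, id, ← T.sq_singularValues_fin rfl]
      exact pow_le_pow_left₀ (T.singularValues_nonneg _)
        (T.singularValues_antitone (Nat.zero_le _)) 2) u
  rw [inner_adjoint_comp_self, ← mul_pow] at h
  exact le_of_sq_le_sq h (mul_nonneg (T.singularValues_nonneg _) (norm_nonneg _))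

end SingularValues

theorem sigmaMin_mul_norm_le {a b : ℕ} (M : Matrix (Fin a) (Fin b) ℝ) (u : Vec b) :
    sigmaMin M * ‖u‖ ≤ ‖Matrix.toEuclideanLin M u‖ :=
  singularValues_mul_norm_le _ finrank_euclideanSpace_fin u

theorem norm_le_sigmaMax_mul {a b : ℕ} (M : Matrix (Fin a) (Fin b) ℝ) (u : Vec b) :
    ‖Matrix.toEuclideanLin M u‖ ≤ sigmaMax M * ‖u‖ :=
  norm_apply_le_singularValues _ u

theorem sigmaMin_nonneg {a b : ℕ} (M : Matrix (Fin a) (Fin b) ℝ) : 0 ≤ sigmaMin M :=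
  LinearMap.singularValues_nonneg _ _

theorem sigmaMin_le_sigmaMax {a b : ℕ} (M : Matrix (Fin a) (Fin b) ℝ) : sigmaMin M ≤ sigmaMax M :=
  LinearMap.singularValues_antitone _ (Nat.zero_le _)

section Hermitian

variable {ι : Type*} [Fintype ι] [DecidableEq ι] {M : Matrix ι ι ℝ}

theorem toEuclideanLin_eigenvectorBasis (hM : M.IsHermitian) (i : ι) :
    Matrix.toEuclideanLin M (hM.eigenvectorBasis i) = hM.eigenvalues i • hM.eigenvectorBasis i := by
  refine (WithLp.ofLp_injective 2) ?_
  rw [WithLp.ofLp_smul, ← hM.mulVec_eigenvectorBasis]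
  rfl

theorem lambdaMin_mul_norm_sq_le (hM : M.IsHermitian) (u : EuclideanSpace ℝ ι) :
    lambdaMin M * ‖u‖ ^ 2 ≤ inner ℝ (Matrix.toEuclideanLin M u) u := by
  refine mul_norm_sq_le_inner_apply_self (Matrix.isSymmetric_toEuclideanLin_iff.2 hM)
    hM.eigenvectorBasis (toEuclideanLin_eigenvectorBasis hM) (fun i => ?_) u
  refine csInf_le ?_ (hM.eigenvalues_mem_spectrum_real i)
  rw [hM.spectrum_real_eq_range_eigenvalues]
  exact (finite_range _).bddBelow

theorem inner_le_lambdaMax_mul_norm_sq (hM : M.IsHermitian) (u : EuclideanSpace ℝ ι) :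
    inner ℝ (Matrix.toEuclideanLin M u) u ≤ lambdaMax M * ‖u‖ ^ 2 := by
  refine inner_apply_self_le_mul_norm_sq (Matrix.isSymmetric_toEuclideanLin_iff.2 hM)
    hM.eigenvectorBasis (toEuclideanLin_eigenvectorBasis hM) (fun i => ?_) u
  refine le_csSup ?_ (hM.eigenvalues_mem_spectrum_real i)
  rw [hM.spectrum_real_eq_range_eigenvalues]
  exact (finite_range _).bddAbove

theorem exists_inner_eq_lambdaMin [Nonempty ι] (hM : M.IsHermitian) :
    ∃ u : EuclideanSpace ℝ ι, ‖u‖ = 1 ∧ inner ℝ (Matrix.toEuclideanLin M u) u = lambdaMin M := by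
  obtain ⟨i, hi⟩ : lambdaMin M ∈ range hM.eigenvalues := by
    rw [lambdaMin, hM.spectrum_real_eq_range_eigenvalues]
    exact (range_nonempty _).csInf_mem (finite_range _)
  refine ⟨hM.eigenvectorBasis i, hM.eigenvectorBasis.orthonormal.1 i, ?_⟩
  rw [toEuclideanLin_eigenvectorBasis, real_inner_smul_left, real_inner_self_eq_norm_sq,
    hM.eigenvectorBasis.orthonormal.1 i, hi]
  ring

end Hermitian

/-! ### The kernel matrix -/

section Kernel

variable {q N : ℕ} (V : Type*) [NormedAddCommGroup V] [InnerProductSpace ℝ V] [CompleteSpace V]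
  [RKHS ℝ V (Vec q) (Vec q)]

/-- The kernel matrix is the Gram matrix in `V` of the kernel sections in the coordinate directions;
its symmetry and semidefiniteness come from here. -/
theorem kernelMatrix_apply (z : Fin N → Vec q) (ia jb : Fin N × Fin q) :
    kernelMatrix V z ia jb = inner ℝ (RKHS.kerFun V (z ia.1) (EuclideanSpace.single ia.2 1))
      (RKHS.kerFun V (z jb.1) (EuclideanSpace.single jb.2 1)) := by
  rw [real_inner_comm, ← RKHS.kernel_inner, EuclideanSpace.inner_single_right]
  simp [kernelMatrix]

theorem isHermitian_kernelMatrix (z : Fin N → Vec q) : (kernelMatrix V z).IsHermitian := by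
  ext ia jb
  rw [Matrix.conjTranspose_apply, kernelMatrix_apply, kernelMatrix_apply, real_inner_comm,
    star_trivial]

/-- The block vector with blocks `c i`. -/
def blockVec (c : Fin N → Vec q) : EuclideanSpace ℝ (Fin N × Fin q) :=
  WithLp.toLp 2 fun ia => c ia.1 ia.2

theorem norm_blockVec_sq (c : Fin N → Vec q) : ‖blockVec c‖ ^ 2 = ∑ i, ‖c i‖ ^ 2 := by
  simp only [EuclideanSpace.norm_sq_eq, blockVec, Fintype.sum_prod_type]

theorem exists_blockVec_eq (u : EuclideanSpace ℝ (Fin N × Fin q)) :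
    ∃ c : Fin N → Vec q, blockVec c = u :=
  ⟨fun i => WithLp.toLp 2 fun a => u (i, a), rfl⟩

theorem kerFun_eq_sum (x : Vec q) (c : Vec q) :
    RKHS.kerFun V x c = ∑ a, c a • RKHS.kerFun V x (EuclideanSpace.single a 1) := by
  conv_lhs => rw [← (EuclideanSpace.basisFun (Fin q) ℝ).sum_repr c]
  simp

/-- Converts eigenvalue bounds into bounds for the norm in `V` of a sum of kernel sections, which up
to the factor 1/N is the form of the gradient at a fixed time. -/
theorem inner_kernelMatrix (z : Fin N → Vec q) (c : Fin N → Vec q) :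
    inner ℝ (Matrix.toEuclideanLin (kernelMatrix V z) (blockVec c)) (blockVec c)
      = ‖∑ i, RKHS.kerFun V (z i) (c i)‖ ^ 2 := by
  have hsum : ∑ i, RKHS.kerFun V (z i) (c i) = ∑ ia : Fin N × Fin q,
      c ia.1 ia.2 • RKHS.kerFun V (z ia.1) (EuclideanSpace.single ia.2 1) := by
    rw [Fintype.sum_prod_type]
    exact Finset.sum_congr rfl fun i _ => kerFun_eq_sum V (z i) (c i)
  rw [← real_inner_self_eq_norm_sq, hsum, sum_inner, PiLp.inner_apply]
  refine Finset.sum_congr rfl fun ia _ => ?_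
  rw [inner_sum, real_inner_comm]
  simp only [Matrix.toEuclideanLin, blockVec, Matrix.toLpLin_apply, Matrix.mulVec, dotProduct,
    kernelMatrix_apply, real_inner_smul_left, real_inner_smul_right, RCLike.inner_apply,
    conj_trivial, Finset.sum_mul]
  refine Finset.sum_congr rfl fun jb _ => ?_
  ring

theorem lambdaMin_kernelMatrix_mul_le (z c : Fin N → Vec q) :
    lambdaMin (kernelMatrix V z) * ∑ i, ‖c i‖ ^ 2 ≤ ‖∑ i, RKHS.kerFun V (z i) (c i)‖ ^ 2 := by
  rw [← inner_kernelMatrix, ← norm_blockVec_sq]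
  exact lambdaMin_mul_norm_sq_le (isHermitian_kernelMatrix V z) _

theorem le_lambdaMax_kernelMatrix_mul (z c : Fin N → Vec q) :
    ‖∑ i, RKHS.kerFun V (z i) (c i)‖ ^ 2 ≤ lambdaMax (kernelMatrix V z) * ∑ i, ‖c i‖ ^ 2 := by
  rw [← inner_kernelMatrix, ← norm_blockVec_sq]
  exact inner_le_lambdaMax_mul_norm_sq (isHermitian_kernelMatrix V z) _

theorem exists_eq_lambdaMin_kernelMatrix (hN : 0 < N) (hq : 0 < q) (z : Fin N → Vec q) :
    ∃ c : Fin N → Vec q, ∑ i, ‖c i‖ ^ 2 = 1 ∧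
      ‖∑ i, RKHS.kerFun V (z i) (c i)‖ ^ 2 = lambdaMin (kernelMatrix V z) := by
  have : Nonempty (Fin N × Fin q) := ⟨⟨0, hN⟩, ⟨0, hq⟩⟩
  obtain ⟨u, hu, h⟩ := exists_inner_eq_lambdaMin (isHermitian_kernelMatrix V z)
  obtain ⟨c, rfl⟩ := exists_blockVec_eq u
  refine ⟨c, ?_, ?_⟩
  · rw [← norm_blockVec_sq, hu, one_pow]
  · rw [← inner_kernelMatrix, h]

theorem lambdaMin_kernelMatrix_nonneg (hN : 0 < N) (hq : 0 < q) (z : Fin N → Vec q) :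
    0 ≤ lambdaMin (kernelMatrix V z) := by
  obtain ⟨c, -, hc⟩ := exists_eq_lambdaMin_kernelMatrix V hN hq z
  rw [← hc]
  positivity

end Kernel

/-! ### Continuity of the smallest eigenvalue in the separation -/

/-- Points at distance at most D are joined by an edge, and r selects one point in each connected
component. -/
theorem exists_cluster_representatives {E : Type*} [NormedAddCommGroup E] {N : ℕ} (z : Fin N → E)
    {D : ℝ} (hD : 0 ≤ D) :
    ∃ r : Fin N → Fin N, (∀ i, ‖z i - z (r i)‖ ≤ N * D) ∧
      ∀ i j, r i ≠ r j → D ≤ ‖z i - z j‖ := by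
  let G : SimpleGraph (Fin N) := SimpleGraph.fromRel fun i j => ‖z i - z j‖ ≤ D
  have hadj : ∀ {i j}, G.Adj i j → ‖z i - z j‖ ≤ D := by
    intro i j h
    rcases (SimpleGraph.fromRel_adj _ _ _).1 h with ⟨-, h | h⟩
    · exact h
    · rwa [norm_sub_rev]
  have hwalk : ∀ {i j} (p : G.Walk i j), ‖z i - z j‖ ≤ p.length * D := by
    intro i j p
    induction p with
    | nil => simp
    | cons h p ih =>
      rw [SimpleGraph.Walk.length_cons, Nat.cast_add, Nat.cast_one]
      have := norm_sub_le_norm_sub_add_norm_sub (z _) (z _) (z _) |>.trans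
        (add_le_add (hadj h) ih)
      linarith
  refine ⟨fun i => (G.connectedComponentMk i).out, fun i => ?_, fun i j hij => ?_⟩
  · have hr : G.Reachable i (G.connectedComponentMk i).out := by
      rw [← SimpleGraph.ConnectedComponent.eq]
      exact (Quot.out_eq _).symm
    obtain ⟨p, hp⟩ := hr.exists_isPath
    -- A path repeats no vertex, so it has fewer than N edges, each of length at most D.
    have hlt := hp.length_lt
    rw [Fintype.card_fin] at hlt
    refine (hwalk p).trans ?_
    gcongr
  · by_contra hlt
    refine hij ?_
    rcases eq_or_ne i j with rfl | hne
    · rfl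
    have h : G.Adj i j := (SimpleGraph.fromRel_adj _ _ _).2 ⟨hne, Or.inl (not_le.1 hlt).le⟩
    exact congrArg (fun C : G.ConnectedComponent => Quot.out C)
      (SimpleGraph.ConnectedComponent.eq.2 h.reachable)

/-- Finitely many points can be spread apart by a small displacement. -/
theorem exists_spread {E : Type*} [NormedAddCommGroup E] [NormedSpace ℝ E] {N : ℕ} (hN : 0 < N)
    (z : Fin N → E) {δ δ' : ℝ} (hδ : 0 < δ) (hz : ∀ i j, i ≠ j → δ ≤ ‖z i - z j‖)
    (hle : δ ≤ δ') (hle' : δ' ≤ (1 + 1 / (4 * N)) * δ) :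
    ∃ z' : Fin N → E, (∀ i j, i ≠ j → δ' ≤ ‖z' i - z' j‖) ∧
      ∀ i, ‖z i - z' i‖ ≤ 4 * N * (δ' - δ) := by
  have hN1 : (1 : ℝ) ≤ N := by exact_mod_cast hN
  have hδ' : 0 < δ' := hδ.trans_le hle
  obtain ⟨r, hr1, hr2⟩ := exists_cluster_representatives z (D := 2 * δ') (by positivity)
  set θ := (δ' - δ) / δ with hθ
  have hθ0 : 0 ≤ θ := div_nonneg (sub_nonneg.2 hle) hδ.le
  have hθδ : θ * δ = δ' - δ := div_mul_cancel₀ _ hδ.ne'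
  have hθN : θ * (4 * N) ≤ 1 := by
    rw [hθ, div_mul_eq_mul_div, div_le_one hδ]
    have h2 : (1 + 1 / (4 * (N : ℝ))) * δ * (4 * N) = δ * (4 * N) + δ := by
      field_simp
    have h3 : δ' * (4 * N) ≤ (1 + 1 / (4 * (N : ℝ))) * δ * (4 * N) := by gcongr
    linarith
  have hθ1 : θ ≤ 1 := by nlinarith
  have hδ2 : δ' ≤ 2 * δ := by nlinarith
  have hdisp : ∀ i, ‖θ • (z i - z (r i))‖ ≤ θ * (N * (2 * δ')) := fun i => by
    rw [norm_smul_of_nonneg hθ0]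
    exact mul_le_mul_of_nonneg_left (hr1 i) hθ0
  -- Each cluster is dilated about its representative by 1 + θ = δ'/δ, which lifts distances inside
  -- it to at least δ'. Distinct clusters are at least 2δ' apart, and two displacements of at most
  -- δ'/2 leave δ'.
  refine ⟨fun i => z i + θ • (z i - z (r i)), fun i j hij => ?_, fun i => ?_⟩
  · by_cases hrij : r i = r j
    · have heq : z i + θ • (z i - z (r i)) - (z j + θ • (z j - z (r j)))
          = (1 + θ) • (z i - z j) := by
        rw [hrij]
        module
      rw [heq, norm_smul_of_nonneg (by positivity)]
      have := mul_le_mul_of_nonneg_left (hz i j hij) (by positivity : 0 ≤ 1 + θ)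
      linarith
    · have heq : z i - z j = (z i + θ • (z i - z (r i)) - (z j + θ • (z j - z (r j))))
          - θ • (z i - z (r i)) + θ • (z j - z (r j)) := by
        abel
      have h1 := hr2 i j hrij
      rw [heq] at h1
      have h2 := h1.trans ((norm_add_le _ _).trans (add_le_add (norm_sub_le _ _) le_rfl))
      have h3 := hdisp i
      have h4 := hdisp j
      have h5 : θ * (N * (2 * δ')) ≤ δ' / 2 := by
        have := mul_le_mul_of_nonneg_right hθN (by positivity : 0 ≤ δ' / 2)
        linarith
      linarith
  · rw [sub_add_cancel_left, norm_neg]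
    refine (hdisp i).trans ?_
    have h1 : θ * (N * (2 * δ')) ≤ θ * (N * (2 * (2 * δ))) := by gcongr
    have h2 : θ * (N * (2 * (2 * δ))) = 4 * N * (θ * δ) := by ring
    rw [h2, hθδ] at h1
    exact h1

section SmallLambda

variable {q N : ℕ} {V : Type*} [NormedAddCommGroup V] [InnerProductSpace ℝ V] [CompleteSpace V]
  [RKHS ℝ V (Vec q) (Vec q)] {κ : ℝ}

theorem kerFun_eq_adjoint (x : Vec q) : RKHS.kerFun V x = (evalCLM V x).adjoint := rfl

theorem IsStronglyAdmissible.norm_kerFun_le (hV : IsStronglyAdmissible V κ) (x c : Vec q) :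
    ‖RKHS.kerFun V x c‖ ≤ κ * ‖c‖ := by
  refine ContinuousLinearMap.le_of_opNorm_le _ ?_ _
  rw [kerFun_eq_adjoint, LinearIsometryEquiv.norm_map]
  exact hV.isSmoothFamily.norm_le x

theorem IsStronglyAdmissible.norm_kerFun_sub_le (hV : IsStronglyAdmissible V κ) (x y c : Vec q) :
    ‖RKHS.kerFun V x c - RKHS.kerFun V y c‖ ≤ κ * ‖x - y‖ * ‖c‖ := by
  rw [← sub_apply]
  refine ContinuousLinearMap.le_of_opNorm_le _ ?_ _
  rw [kerFun_eq_adjoint, kerFun_eq_adjoint, ← map_sub, LinearIsometryEquiv.norm_map]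
  exact hV.isSmoothFamily.norm_sub_le x y

/-- A minimising unit vector for z is tested at z'. The two kernel sums have norm at most κN and
differ by at most κNη, so their squares differ by at most 2(κN)²η. -/
theorem lambdaMin_kernelMatrix_le_add (hV : IsStronglyAdmissible V κ) (hN : 0 < N) (hq : 0 < q)
    {z z' : Fin N → Vec q} {η : ℝ} (h : ∀ i, ‖z i - z' i‖ ≤ η) :
    lambdaMin (kernelMatrix V z') ≤ lambdaMin (kernelMatrix V z) + 2 * (κ * N) ^ 2 * η := by
  have hκ := hV.1.le
  obtain ⟨c, hc, hmin⟩ := exists_eq_lambdaMin_kernelMatrix V hN hq z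
  have hc1 : ∀ i, ‖c i‖ ≤ 1 := fun i => by
    refine (sq_le_one_iff₀ (norm_nonneg _)).1 ?_
    rw [← hc]
    exact Finset.single_le_sum (f := fun i => ‖c i‖ ^ 2) (fun _ _ => sq_nonneg _)
      (Finset.mem_univ i)
  have hη : 0 ≤ η := (norm_nonneg _).trans (h ⟨0, hN⟩)
  have hbound : ∀ w : Fin N → Vec q, ‖∑ i, RKHS.kerFun V (w i) (c i)‖ ≤ κ * N := fun w => by
    refine (norm_sum_le_of_le _ fun i _ => ?_).trans (b := ∑ _i : Fin N, κ) (by simp [mul_comm])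
    refine (hV.norm_kerFun_le _ _).trans ?_
    exact mul_le_of_le_one_right hκ (hc1 i)
  have hdiff : ‖∑ i, RKHS.kerFun V (z' i) (c i) - ∑ i, RKHS.kerFun V (z i) (c i)‖
      ≤ κ * N * η := by
    rw [← Finset.sum_sub_distrib]
    refine (norm_sum_le_of_le _ fun i _ => ?_).trans (b := ∑ _i : Fin N, κ * η)
      (by simp; linarith)
    refine (hV.norm_kerFun_sub_le _ _ _).trans ?_
    rw [norm_sub_rev]
    exact (mul_le_of_le_one_right (by positivity) (hc1 i)).trans (by gcongr; exact h i)
  have h1 := lambdaMin_kernelMatrix_mul_le V z' c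
  rw [hc, mul_one] at h1
  refine h1.trans ?_
  rw [← hmin]
  have ha := hbound z
  have hb := hbound z'
  have hab := (norm_sub_norm_le _ _).trans hdiff
  have ha0 := norm_nonneg (∑ i, RKHS.kerFun V (z i) (c i))
  have hb0 := norm_nonneg (∑ i, RKHS.kerFun V (z' i) (c i))
  generalize ‖∑ i, RKHS.kerFun V (z i) (c i)‖ = a at *
  generalize ‖∑ i, RKHS.kerFun V (z' i) (c i)‖ = b at *
  have h2 := mul_le_mul hab (add_le_add hb ha) (by positivity) (by positivity)
  nlinarith

theorem bddBelow_lambdaMin (hN : 0 < N) (hq : 0 < q) (P : (Fin N → Vec q) → Prop) :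
    BddBelow {r | ∃ z : Fin N → Vec q, P z ∧ r = lambdaMin (kernelMatrix V z)} :=
  ⟨0, by rintro _ ⟨z, -, rfl⟩; exact lambdaMin_kernelMatrix_nonneg V hN hq z⟩

theorem smallLambda_le (hN : 0 < N) (hq : 0 < q) {s : ℝ} {z : Fin N → Vec q}
    (hz : ∀ i j, i ≠ j → s⁻¹ ≤ ‖z i - z j‖) :
    smallLambda V N s ≤ lambdaMin (kernelMatrix V z) :=
  csInf_le (bddBelow_lambdaMin hN hq _) ⟨z, hz, rfl⟩

/-- Positivity of the value shows that some configuration has the required separation: the infimum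
of the empty set is 0. -/
theorem le_smallLambda {s m : ℝ} (hs : 0 < smallLambda V N s)
    (h : ∀ z : Fin N → Vec q, (∀ i j, i ≠ j → s⁻¹ ≤ ‖z i - z j‖) →
      m ≤ lambdaMin (kernelMatrix V z)) : m ≤ smallLambda V N s := by
  refine le_csInf ?_ ?_
  · by_contra hne
    rw [smallLambda, not_nonempty_iff_eq_empty.1 hne, Real.sInf_empty] at hs
    exact hs.false
  · rintro _ ⟨z, hz, rfl⟩
    exact h z hz

/-- A larger separation shrinks the set of configurations, which gives one inequality. For the
other, any δ-separated configuration is spread to a δ'-separated one at a cost linear in δ' - δ. -/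
theorem abs_smallLambda_inv_sub_le (hV : IsStronglyAdmissible V κ) (hU : IsUniversal V N)
    (hN : 0 < N) (hq : 0 < q) {δ δ' : ℝ} (hδ : 0 < δ) (hle : δ ≤ δ')
    (hle' : δ' ≤ (1 + 1 / (4 * N)) * δ) :
    |smallLambda V N δ'⁻¹ - smallLambda V N δ⁻¹| ≤ 2 * (κ * N) ^ 2 * (4 * N) * (δ' - δ) := by
  have h1 : smallLambda V N δ⁻¹ ≤ smallLambda V N δ'⁻¹ :=
    le_smallLambda (hU.2 δ' (hδ.trans_le hle)) fun z hz => smallLambda_le hN hq fun i j hij => by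
      have := hz i j hij
      rw [inv_inv] at this ⊢
      exact hle.trans this
  have h2 : smallLambda V N δ'⁻¹ - 2 * (κ * N) ^ 2 * (4 * N * (δ' - δ))
      ≤ smallLambda V N δ⁻¹ := by
    refine le_smallLambda (hU.2 δ hδ) fun z hz => ?_
    simp only [inv_inv] at hz
    obtain ⟨z', hz', hd⟩ := exists_spread hN z hδ hz hle hle'
    have h3 : smallLambda V N δ'⁻¹ ≤ _ := smallLambda_le (V := V) hN hq (z := z')
      (by simpa using hz')
    linarith [lambdaMin_kernelMatrix_le_add hV hN hq hd]
  rw [abs_of_nonneg (sub_nonneg.2 h1)]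
  linarith

theorem continuousAt_smallLambda_inv (hV : IsStronglyAdmissible V κ) (hU : IsUniversal V N)
    (hN : 0 < N) (hq : 0 < q) {δ₀ : ℝ} (hδ₀ : 0 < δ₀) :
    ContinuousAt (fun δ => smallLambda V N δ⁻¹) δ₀ := by
  have hN' : (0 : ℝ) < N := by exact_mod_cast hN
  set c : ℝ := 1 + 1 / (4 * N) with hc
  have hc1 : 1 < c := by
    rw [hc]
    have : (0 : ℝ) < 1 / (4 * N) := by positivity
    linarith
  rw [ContinuousAt, tendsto_iff_dist_tendsto_zero]
  have hlim : Filter.Tendsto (fun δ => 2 * (κ * N) ^ 2 * (4 * N) * |δ - δ₀|) (nhds δ₀)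
      (nhds 0) := by
    have : Continuous fun δ : ℝ => 2 * (κ * N) ^ 2 * (4 * N) * |δ - δ₀| := by fun_prop
    simpa using this.tendsto δ₀
  refine squeeze_zero' (Filter.Eventually.of_forall fun _ => dist_nonneg) ?_ hlim
  have e1 : ∀ᶠ δ in nhds δ₀, δ < c * δ₀ := Iio_mem_nhds (by nlinarith)
  have e2 : ∀ᶠ δ in nhds δ₀, δ₀ < c * δ :=
    (show ContinuousAt (fun δ : ℝ => c * δ) δ₀ by fun_prop).eventually
      (Ioi_mem_nhds (lt_mul_of_one_lt_left hδ₀ hc1))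
  filter_upwards [e1, e2, Ioi_mem_nhds hδ₀] with δ h1 h2 h3
  rw [Real.dist_eq]
  rcases le_total δ₀ δ with h | h
  · rw [abs_of_nonneg (sub_nonneg.2 h)]
    exact abs_smallLambda_inv_sub_le hV hU hN hq hδ₀ h h1.le
  · rw [abs_sub_comm, abs_sub_comm δ, abs_of_nonneg (sub_nonneg.2 h)]
    exact abs_smallLambda_inv_sub_le hV hU hN hq h3 h h2.le

theorem continuousOn_smallLambda (hV : IsStronglyAdmissible V κ) (hU : IsUniversal V N)
    (hN : 0 < N) (hq : 0 < q) : ContinuousOn (smallLambda V N) (Ioi 0) := by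
  intro s hs
  have h := (continuousAt_smallLambda_inv hV hU hN hq (inv_pos.2 hs)).comp
    (continuousAt_inv₀ (ne_of_gt hs))
  simp only [Function.comp_def, inv_inv] at h
  exact h.continuousWithinAt

theorem smallLambda_pos (hU : IsUniversal V N) {s : ℝ} (hs : 0 < s) : 0 < smallLambda V N s := by
  simpa using hU.2 s⁻¹ (inv_pos.2 hs)

/-- For a single point there is no constraint on the separation. -/
theorem smallLambda_eq_of_subsingleton [Subsingleton (Fin N)] (s t : ℝ) :
    smallLambda V N s = smallLambda V N t := by
  simp [smallLambda]

end SmallLambda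

/-! ### The gradient of the empirical risk -/

/-- On a probability space the L¹ norm is at most the L² norm; this puts ‖v‖ in the Gronwall
exponents. Allowing any representative covers the pointwise difference v' - v. -/
theorem integral_norm_le_of_ae_eq {V : Type*} [NormedAddCommGroup V] (w : Control V) {f : ℝ → V}
    (hf : f =ᵐ[unitTime] w) : ∫ s in (0 : ℝ)..1, ‖f s‖ ≤ ‖w‖ := by
  have hw := Lp.memLp w
  rw [intervalIntegral_eq_integral_unitTime, integral_congr_ae (f := fun s => ‖f s‖) (g := fun s => ‖w s‖)
      (hf.fun_comp norm), Lp.norm_def,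
    integral_norm_eq_lintegral_enorm hw.1, ← eLpNorm_one_eq_lintegral_enorm]
  exact ENNReal.toReal_mono hw.2.ne (eLpNorm_le_eLpNorm_of_exponent_le one_le_two hw.1)

theorem memLp_of_continuousOn {V : Type*} [NormedAddCommGroup V] {g : ℝ → V}
    (hg : ContinuousOn g (Icc 0 1)) : MemLp g 2 unitTime := by
  obtain ⟨C, hC⟩ := isCompact_Icc.exists_bound_of_continuousOn hg
  refine MemLp.of_bound (hg.aestronglyMeasurable_of_isCompact isCompact_Icc measurableSet_Icc) C ?_
  rw [ae_restrict_iff' measurableSet_Icc]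
  exact Filter.Eventually.of_forall hC

/-! ### Norms and inner products in L²([0,1], V) -/

section Lp

variable {V : Type*} [NormedAddCommGroup V] [InnerProductSpace ℝ V]

theorem norm_sq_toLp_eq_integral {g : ℝ → V} (hg : MemLp g 2 unitTime) :
    ‖hg.toLp g‖ ^ 2 = ∫ s, ‖g s‖ ^ 2 ∂unitTime := by
  rw [← real_inner_self_eq_norm_sq, L2.inner_def]
  refine integral_congr_ae ?_
  filter_upwards [hg.coeFn_toLp] with s hs
  rw [hs, real_inner_self_eq_norm_sq]

theorem inner_toLp_eq_integral {g f : ℝ → V} (hg : MemLp g 2 unitTime) (w : Control V)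
    (hf : f =ᵐ[unitTime] w) :
    inner ℝ (hg.toLp g) w = ∫ s, inner ℝ (g s) (f s) ∂unitTime := by
  rw [L2.inner_def]
  refine integral_congr_ae ?_
  filter_upwards [hg.coeFn_toLp, hf] with s hs hs'
  rw [hs, hs']

theorem norm_sq_toLp_le {g : ℝ → V} (hg : MemLp g 2 unitTime) {b : ℝ}
    (h : ∀ s ∈ Icc (0 : ℝ) 1, ‖g s‖ ^ 2 ≤ b) : ‖hg.toLp g‖ ^ 2 ≤ b := by
  rw [norm_sq_toLp_eq_integral]
  have := integral_mono_ae ((memLp_two_iff_integrable_sq_norm hg.1).1 hg) (integrable_const b)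
    ((ae_restrict_iff' measurableSet_Icc).2 (Filter.Eventually.of_forall h))
  simpa using this

theorem le_norm_sq_toLp {g : ℝ → V} (hg : MemLp g 2 unitTime) {a : ℝ}
    (h : ∀ s ∈ Icc (0 : ℝ) 1, a ≤ ‖g s‖ ^ 2) : a ≤ ‖hg.toLp g‖ ^ 2 := by
  rw [norm_sq_toLp_eq_integral]
  have := integral_mono_ae (integrable_const a) ((memLp_two_iff_integrable_sq_norm hg.1).1 hg)
    ((ae_restrict_iff' measurableSet_Icc).2 (Filter.Eventually.of_forall h))
  simpa using this

end Lp

theorem inner_toEuclideanLin_transpose {a b : ℕ} (B : Matrix (Fin a) (Fin b) ℝ) (r : Vec a)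
    (w : Vec b) : inner ℝ (Matrix.toEuclideanLin B.transpose r) w
      = inner ℝ r (Matrix.toEuclideanLin B w) := by
  rw [← Matrix.conjTranspose_eq_transpose_of_trivial, Matrix.toEuclideanLin_conjTranspose_eq_adjoint,
    LinearMap.adjoint_inner_left]

section Risk

variable {q d d' N : ℕ} {V : Type*} [NormedAddCommGroup V] [InnerProductSpace ℝ V]
  [RKHS ℝ V (Vec q) (Vec q)] {κ : ℝ}

/-- The forward problem is by definition the flow of the evaluation family, so existence makes the
`epsilon` choice an actual solution. -/
theorem isFlow_forwardSolution (hV : IsStronglyAdmissible V κ) (v : Control V) (x₀ : Vec q) :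
    IsFlow (evalCLM V) v x₀ (forwardSolution v x₀) :=
  Classical.epsilon_spec (p := fun z => IsForwardSolution v x₀ z)
    (exists_isFlow hV.isSmoothFamily (Lp.memLp v) x₀)

theorem sum_norm_sq_eq_risk (hN : 0 < N) (A : Matrix (Fin q) (Fin d) ℝ)
    (B : Matrix (Fin d') (Fin q) ℝ) (x : Fin N → Vec d) (y : Fin N → Vec d') (v : Control V) :
    ∑ i, ‖output A B v (x i) - y i‖ ^ 2 = 2 * N * empiricalRisk A B x y v := by
  have : (N : ℝ) ≠ 0 := by exact_mod_cast hN.ne'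
  rw [empiricalRisk]
  field_simp

/-- First order expansion of the loss of one data point. -/
theorem exists_loss_expansion (hV : IsStronglyAdmissible V κ) (A : Matrix (Fin q) (Fin d) ℝ)
    (B : Matrix (Fin d') (Fin q) ℝ) (x : Vec d) (y : Vec d') (v : Control V) {p : ℝ → Vec q}
    (hp : IsAdjointFlow (derivEvalCLM hV) v (forwardSolution v (Matrix.toEuclideanLin A x))
      (Matrix.toEuclideanLin B.transpose (output A B v x - y)) p) :
    ∃ C, ∀ v' : Control V, |1 / 2 * ‖output A B v' x - y‖ ^ 2 - 1 / 2 * ‖output A B v x - y‖ ^ 2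
      - ∫ s in (0 : ℝ)..1, inner ℝ (p s) ((v' s - v s : V)
          (forwardSolution v (Matrix.toEuclideanLin A x) s))| ≤ C * ‖v' - v‖ ^ 2 := by
  have hE := hV.isSmoothFamily
  set z := forwardSolution v (Matrix.toEuclideanLin A x) with hz
  set r := output A B v x - y with hr
  set T := (Matrix.toEuclideanLin B).toContinuousLinearMap with hT
  have hzf : IsFlow (evalCLM V) v (Matrix.toEuclideanLin A x) z := isFlow_forwardSolution hV v _
  have hR := integral_norm_le_of_ae_eq v (Filter.EventuallyEq.refl _ _)
  obtain ⟨C₁, hC₁⟩ : ∃ C₁ : ℝ, C₁ = ‖Matrix.toEuclideanLin B.transpose r‖ *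
    Real.exp (κ * ‖v‖) * (κ * (κ * Real.exp (κ * ‖v‖)) ^ 2 * ‖v‖
          + κ * (κ * Real.exp (κ * ‖v‖))) := ⟨_, rfl⟩
  refine ⟨C₁ + 1 / 2 * (‖T‖ * (κ * Real.exp (κ * ‖v‖))) ^ 2, fun v' => ?_⟩
  set z' := forwardSolution v' (Matrix.toEuclideanLin A x) with hz'
  have hzf' : IsFlow (evalCLM V) v' (Matrix.toEuclideanLin A x) z' := isFlow_forwardSolution hV v' _
  have hH : ∫ s in (0 : ℝ)..1, ‖v' s - v s‖ ≤ ‖v' - v‖ :=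
    integral_norm_le_of_ae_eq (v' - v) (Lp.coeFn_sub v' v).symm
  have h1 := abs_inner_endpoint_sub_le hE (Lp.memLp v) (Lp.memLp v') hR hH hzf hzf' hp
  have h2 := IsFlow.norm_sub_le_of_control hE (Lp.memLp v) (Lp.memLp v') hR hH hzf hzf'
    (t := 1) (by simp)
  rw [← hC₁, inner_toEuclideanLin_transpose] at h1
  have hr' : output A B v' x - y = r + T (z' 1 - z 1) := by
    rw [map_sub, hr, output, output]
    simp only [hT, LinearMap.coe_toContinuousLinearMap', ← hz, ← hz']
    abel
  have h3 : ‖T (z' 1 - z 1)‖ ^ 2 ≤ (‖T‖ * (κ * Real.exp (κ * ‖v‖))) ^ 2 * ‖v' - v‖ ^ 2 := by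
    rw [← mul_pow]
    refine pow_le_pow_left₀ (norm_nonneg _) ((T.le_opNorm _).trans ?_) 2
    have := mul_le_mul_of_nonneg_left h2 (norm_nonneg T)
    linarith
  -- The square expands exactly; its second order term is quadratic in v' - v by the Lipschitz
  -- dependence of the endpoint on the control.
  have h4 : 1 / 2 * ‖output A B v' x - y‖ ^ 2 - 1 / 2 * ‖r‖ ^ 2
      = inner ℝ r (T (z' 1 - z 1)) + 1 / 2 * ‖T (z' 1 - z 1)‖ ^ 2 := by
    rw [hr', norm_add_sq_real]
    ring
  rw [h4, add_sub_right_comm]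
  refine (abs_add_le _ _).trans ?_
  rw [abs_of_nonneg (by positivity : 0 ≤ 1 / 2 * ‖T (z' 1 - z 1)‖ ^ 2), add_mul]
  refine add_le_add h1 ?_
  linarith

variable [CompleteSpace V]

theorem continuousOn_kerFun_apply (hV : IsStronglyAdmissible V κ) {z p : ℝ → Vec q} {s : Set ℝ}
    (hz : ContinuousOn z s) (hp : ContinuousOn p s) :
    ContinuousOn (fun t => RKHS.kerFun V (z t) (p t)) s := by
  have hk : Continuous fun x : Vec q => RKHS.kerFun V x :=
    ContinuousLinearMap.adjoint.continuous.comp hV.isSmoothFamily.continuous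
  exact (hk.comp_continuousOn hz).clm_apply hp

/-- The reproducing property ⟨K(·, z)p, w⟩ = ⟨p, w(z)⟩ turns the linear term of each loss expansion
into an inner product in L²([0,1], V). The quadratic remainders then add up. -/
theorem hasGradientAt_empiricalRisk (hV : IsStronglyAdmissible V κ) (A : Matrix (Fin q) (Fin d) ℝ)
    (B : Matrix (Fin d') (Fin q) ℝ) (x : Fin N → Vec d) (y : Fin N → Vec d') (v : Control V)
    {p : Fin N → ℝ → Vec q}
    (hp : ∀ i, IsAdjointFlow (derivEvalCLM hV) v
      (forwardSolution v (Matrix.toEuclideanLin A (x i)))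
      (Matrix.toEuclideanLin B.transpose (output A B v (x i) - y i)) (p i))
    (hg : MemLp (fun s => (1 / (N : ℝ)) • ∑ i, RKHS.kerFun V
      (forwardSolution v (Matrix.toEuclideanLin A (x i)) s) (p i s)) 2 unitTime) :
    HasGradientAt (empiricalRisk A B x y) (hg.toLp _) v := by
  choose C hC using fun i => exists_loss_expansion hV A B (x i) (y i) v (hp i)
  refine hasGradientAt_iff_hasFDerivAt.2 (hasFDerivAt_of_norm_taylor_le
    (C := 1 / (N : ℝ) * ∑ i, C i) fun v' => ?_)
  have hzc : ∀ i, ContinuousOn (forwardSolution v (Matrix.toEuclideanLin A (x i))) (Icc 0 1) :=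
    fun i => (isFlow_forwardSolution hV v _).continuousOn
  have hinner : inner ℝ (hg.toLp _) (v' - v) = 1 / (N : ℝ) * ∑ i, ∫ s in (0 : ℝ)..1,
      inner ℝ (p i s) ((v' s - v s : V)
        (forwardSolution v (Matrix.toEuclideanLin A (x i)) s)) := by
    rw [inner_toLp_eq_integral hg (v' - v) (Lp.coeFn_sub v' v).symm]
    simp only [intervalIntegral_eq_integral_unitTime]
    rw [← integral_finsetSum, ← integral_const_mul]
    · refine integral_congr_ae (Filter.Eventually.of_forall fun s => ?_)
      simp only [real_inner_smul_left, sum_inner, RKHS.kerFun_inner, Pi.sub_apply]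
    · intro i _
      have h1 : MemLp (fun s => RKHS.kerFun V
          (forwardSolution v (Matrix.toEuclideanLin A (x i)) s) (p i s)) 2 unitTime :=
        memLp_of_continuousOn (continuousOn_kerFun_apply hV (hzc i) (hp i).1)
      refine (L2.integrable_inner (𝕜 := ℝ) (h1.toLp _) (v' - v)).congr ?_
      filter_upwards [h1.coeFn_toLp, Lp.coeFn_sub v' v] with s hs hs'
      rw [hs, hs', RKHS.kerFun_inner, Pi.sub_apply]
  rw [InnerProductSpace.toDual_apply_apply, hinner, Real.norm_eq_abs]
  have heq : empiricalRisk A B x y v' - empiricalRisk A B x y v - 1 / (N : ℝ) * ∑ i,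
      ∫ s in (0 : ℝ)..1, inner ℝ (p i s) ((v' s - v s : V)
        (forwardSolution v (Matrix.toEuclideanLin A (x i)) s))
      = 1 / (N : ℝ) * ∑ i, (1 / 2 * ‖output A B v' (x i) - y i‖ ^ 2
        - 1 / 2 * ‖output A B v (x i) - y i‖ ^ 2 - ∫ s in (0 : ℝ)..1, inner ℝ (p i s)
          ((v' s - v s : V) (forwardSolution v (Matrix.toEuclideanLin A (x i)) s))) := by
    rw [Finset.sum_sub_distrib, Finset.sum_sub_distrib, ← Finset.mul_sum, ← Finset.mul_sum,
      empiricalRisk, empiricalRisk]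
    ring
  rw [heq, abs_mul, abs_of_nonneg (by positivity : 0 ≤ 1 / (N : ℝ)), mul_assoc]
  refine mul_le_mul_of_nonneg_left ((Finset.abs_sum_le_sum_abs _ _).trans ?_) (by positivity)
  rw [Finset.sum_mul]
  exact Finset.sum_le_sum fun i _ => hC i v'

/-! ### The two bounds for the gradient -/

theorem lambdaMin_le_lambdaMax_kernelMatrix (hN : 0 < N) (hq : 0 < q) (z : Fin N → Vec q) :
    lambdaMin (kernelMatrix V z) ≤ lambdaMax (kernelMatrix V z) := by
  obtain ⟨c, hc, h⟩ := exists_eq_lambdaMin_kernelMatrix V hN hq z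
  have := le_lambdaMax_kernelMatrix_mul V z c
  rwa [h, hc, mul_one] at this

theorem lambdaMax_le_bigLambda (hU : IsUniversal V N) (z : Fin N → Vec q) :
    lambdaMax (kernelMatrix V z) ≤ bigLambda V N :=
  le_csSup hU.1 ⟨z, rfl⟩

theorem smallLambda_nonneg (hN : 0 < N) (hq : 0 < q) (s : ℝ) : 0 ≤ smallLambda V N s :=
  Real.sInf_nonneg (by
    rintro _ ⟨z, -, rfl⟩
    exact lambdaMin_kernelMatrix_nonneg V hN hq z)

theorem bigLambda_nonneg (hU : IsUniversal V N) (hN : 0 < N) (hq : 0 < q) : 0 ≤ bigLambda V N :=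
  (lambdaMin_kernelMatrix_nonneg V hN hq 0).trans
    ((lambdaMin_le_lambdaMax_kernelMatrix hN hq 0).trans (lambdaMax_le_bigLambda hU 0))

theorem smallLambda_le_bigLambda (hU : IsUniversal V N) (hN : 0 < N) (hq : 0 < q) {s : ℝ}
    (hs : 0 < s) : smallLambda V N s ≤ bigLambda V N := by
  have hne : {r | ∃ z : Fin N → Vec q, (∀ i j, i ≠ j → s⁻¹ ≤ ‖z i - z j‖) ∧
      r = lambdaMin (kernelMatrix V z)}.Nonempty := by
    by_contra hne
    have := smallLambda_pos hU hs
    rw [smallLambda, not_nonempty_iff_eq_empty.1 hne, Real.sInf_empty] at this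
    exact this.false
  obtain ⟨_, z, hz, rfl⟩ := hne
  exact (smallLambda_le hN hq hz).trans
    ((lambdaMin_le_lambdaMax_kernelMatrix hN hq z).trans (lambdaMax_le_bigLambda hU z))

/-! ### Separation of the data -/

theorem dataSeparation_le {d N : ℕ} (x : Fin N → Vec d) {i j : Fin N} (hij : i ≠ j) :
    dataSeparation x ≤ ‖x i - x j‖ :=
  csInf_le ⟨0, by rintro _ ⟨i, j, -, rfl⟩; exact norm_nonneg _⟩ ⟨i, j, hij, rfl⟩

theorem dataSeparation_pos {d N : ℕ} {x : Fin N → Vec d} (hx : Function.Injective x)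
    [Nontrivial (Fin N)] : 0 < dataSeparation x := by
  have hfin : {r | ∃ i j, i ≠ j ∧ r = ‖x i - x j‖}.Finite := by
    refine (finite_range fun ij : Fin N × Fin N => ‖x ij.1 - x ij.2‖).subset ?_
    rintro _ ⟨i, j, -, rfl⟩
    exact ⟨(i, j), rfl⟩
  obtain ⟨i, j, hij⟩ := exists_pair_ne (Fin N)
  obtain ⟨i', j', hij', h⟩ := Set.Nonempty.csInf_mem
    (show {r | ∃ i j, i ≠ j ∧ r = ‖x i - x j‖}.Nonempty from ⟨_, i, j, hij, rfl⟩) hfin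
  rw [dataSeparation, h]
  exact norm_sub_pos_iff.2 (hx.ne hij')

/-- Applied to A, this supplies the positivity of q that the eigenvalue arguments need. -/
theorem pos_of_sigmaMin_pos {a b : ℕ} {M : Matrix (Fin a) (Fin b) ℝ} (h : 0 < sigmaMin M) :
    0 < a ∧ 0 < b := by
  have hb : 0 < b := by
    by_contra hb
    obtain rfl : b = 0 := by omega
    rw [sigmaMin, LinearMap.singularValues_of_finrank_le _ (by simp)] at h
    exact h.false
  refine ⟨?_, hb⟩
  by_contra ha
  obtain rfl : a = 0 := by omega
  have h1 := sigmaMin_mul_norm_le M (EuclideanSpace.single ⟨0, hb⟩ 1)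
  rw [Subsingleton.elim (Matrix.toEuclideanLin M _) 0, norm_zero] at h1
  simp only [PiLp.norm_single, norm_one, mul_one] at h1
  exact h.not_ge h1

theorem gradient_bounds (hN : 0 < N) (hV : IsStronglyAdmissible V κ) (hU : IsUniversal V N)
    (A : Matrix (Fin q) (Fin d) ℝ) (B : Matrix (Fin d') (Fin q) ℝ) (hA : 0 < sigmaMin A)
    (x : Fin N → Vec d) (y : Fin N → Vec d') (v : Control V) :
    DifferentiableAt ℝ (empiricalRisk A B x y) v ∧
    2 * plLower V N κ A B (dataSeparation x) ‖v‖ * empiricalRisk A B x y v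
        ≤ ‖gradient (empiricalRisk A B x y) v‖ ^ 2 ∧
      ‖gradient (empiricalRisk A B x y) v‖ ^ 2
        ≤ 2 * plUpper V N κ B ‖v‖ * empiricalRisk A B x y v := by
  have hq : 0 < q := (pos_of_sigmaMin_pos hA).1
  have hN0 : (N : ℝ) ≠ 0 := by exact_mod_cast hN.ne'
  have hE := hV.isSmoothFamily
  have hv := Lp.memLp v
  have hR := integral_norm_le_of_ae_eq v (Filter.EventuallyEq.refl _ _)
  set z : Fin N → ℝ → Vec q := fun i => forwardSolution v (Matrix.toEuclideanLin A (x i)) with hz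
  have hzf : ∀ i, IsFlow (evalCLM V) v (Matrix.toEuclideanLin A (x i)) (z i) := fun i =>
    isFlow_forwardSolution hV v _
  set r : Fin N → Vec d' := fun i => output A B v (x i) - y i with hr
  choose p hp using fun i => exists_isAdjointFlow hE hv (hzf i).continuousOn
    (Matrix.toEuclideanLin B.transpose (r i))
  have hg : MemLp (fun s => (1 / (N : ℝ)) • ∑ i, RKHS.kerFun V (z i s) (p i s)) 2 unitTime :=
    memLp_of_continuousOn (continuousOn_const.smul (continuousOn_finsetSum _ fun i _ =>
      continuousOn_kerFun_apply hV (hzf i).continuousOn (hp i).1))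
  have hgrad := hasGradientAt_empiricalRisk hV A B x y v hp hg
  have hrisk : ∑ i, ‖r i‖ ^ 2 = 2 * N * empiricalRisk A B x y v :=
    sum_norm_sq_eq_risk hN A B x y v
  have hnorm : ∀ s, ‖(1 / (N : ℝ)) • ∑ i, RKHS.kerFun V (z i s) (p i s)‖ ^ 2
      = (1 / (N : ℝ)) ^ 2 * ‖∑ i, RKHS.kerFun V (z i s) (p i s)‖ ^ 2 := fun s => by
    rw [norm_smul_of_nonneg (by positivity), mul_pow]
  refine ⟨hgrad.hasFDerivAt.differentiableAt, ?_, ?_⟩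
  · rw [hgrad.gradient]
    refine le_norm_sq_toLp hg fun s hs => ?_
    rw [hnorm]
    have h1 := lambdaMin_kernelMatrix_mul_le V (fun i => z i s) (fun i => p i s)
    -- Gronwall backwards from s to 0: the points at time s are separated by at least σ_min(A) δ
    -- e^{-κ‖v‖}. With a single point the condition is empty.
    have h2 : smallLambda V N ((sigmaMin A)⁻¹ * (dataSeparation x)⁻¹ * Real.exp (κ * ‖v‖))
        ≤ lambdaMin (kernelMatrix V fun i => z i s) := by
      refine smallLambda_le hN hq fun i j hij => ?_
      have h3 := IsFlow.norm_sub_le hE hv hR (hzf i) (hzf j) hs (t := 0) (by simp)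
      rw [(hzf i).apply_zero, (hzf j).apply_zero, ← map_sub] at h3
      have h4 := (mul_le_mul_of_nonneg_left (dataSeparation_le x hij) hA.le).trans
        ((sigmaMin_mul_norm_le A _).trans h3)
      rw [mul_inv, mul_inv, inv_inv, inv_inv, ← div_eq_mul_inv, div_le_iff₀ (Real.exp_pos _)]
      exact h4
    -- Here the final value Bᵀrⁱ is bounded by the state at time s, which gives a lower bound for
    -- the latter.
    have h5 : (sigmaMin B.transpose * Real.exp (-(κ * ‖v‖))) ^ 2 * ∑ i, ‖r i‖ ^ 2
        ≤ ∑ i, ‖p i s‖ ^ 2 := by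
      rw [Finset.mul_sum]
      refine Finset.sum_le_sum fun i _ => ?_
      rw [← mul_pow]
      have := sigmaMin_nonneg B.transpose
      refine pow_le_pow_left₀ (by positivity) ?_ 2
      have h6 := (hp i).norm_le hE hv hR (hzf i).continuousOn hs (t := 1) (by simp)
      rw [(hp i).apply_one] at h6
      have h7 := (sigmaMin_mul_norm_le B.transpose (r i)).trans h6
      rw [Real.exp_neg, mul_right_comm, ← div_eq_mul_inv, div_le_iff₀ (Real.exp_pos _)]
      exact h7
    have h8 := smallLambda_nonneg (V := V) hN hq
      ((sigmaMin A)⁻¹ * (dataSeparation x)⁻¹ * Real.exp (κ * ‖v‖))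
    rw [hrisk] at h5
    have h9 := (mul_le_mul h2 h5 (by
      rw [← hrisk]
      positivity) (h8.trans h2)).trans h1
    -- The factor N⁻² from the gradient and 2N from ∑ᵢ ‖rⁱ‖² = 2N L(v) combine to 2/N.
    refine le_trans (le_of_eq ?_) (mul_le_mul_of_nonneg_left h9 (sq_nonneg _))
    have hexp : Real.exp (-(2 * κ * ‖v‖)) = Real.exp (-(κ * ‖v‖)) ^ 2 := by
      rw [← Real.exp_nat_mul]
      congr 1
      push_cast
      ring
    rw [plLower, hexp]
    field_simp
  · rw [hgrad.gradient]
    refine norm_sq_toLp_le hg fun s hs => ?_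
    rw [hnorm]
    have h1 := le_lambdaMax_kernelMatrix_mul V (fun i => z i s) (fun i => p i s)
    have h2 := lambdaMax_le_bigLambda hU fun i => z i s
    have h5 : ∑ i, ‖p i s‖ ^ 2
        ≤ (sigmaMax B.transpose * Real.exp (κ * ‖v‖)) ^ 2 * ∑ i, ‖r i‖ ^ 2 := by
      rw [Finset.mul_sum]
      refine Finset.sum_le_sum fun i _ => ?_
      rw [← mul_pow]
      refine pow_le_pow_left₀ (norm_nonneg _) ?_ 2
      have h6 := (hp i).norm_le hE hv hR (hzf i).continuousOn (s := 1) (by simp) hs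
      rw [(hp i).apply_one] at h6
      refine h6.trans ?_
      rw [mul_right_comm]
      exact mul_le_mul_of_nonneg_right (norm_le_sigmaMax_mul _ _) (Real.exp_pos _).le
    rw [hrisk] at h5
    have h9 := h1.trans (mul_le_mul h2 h5 (by positivity) (bigLambda_nonneg hU hN hq))
    refine (mul_le_mul_of_nonneg_left h9 (sq_nonneg _)).trans (le_of_eq ?_)
    have hexp : Real.exp (2 * κ * ‖v‖) = Real.exp (κ * ‖v‖) ^ 2 := by
      rw [← Real.exp_nat_mul]
      congr 1
      push_cast
      ring
    rw [plUpper, hexp]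
    field_simp

/-! ### Continuity and positivity of the two bounds -/

theorem continuous_plLower_and_smallLambda_pos (hN : 0 < N) (hV : IsStronglyAdmissible V κ) (hU : IsUniversal V N)
    {A : Matrix (Fin q) (Fin d) ℝ} (B : Matrix (Fin d') (Fin q) ℝ) (hA : 0 < sigmaMin A)
    {x : Fin N → Vec d} (hx : Function.Injective x) :
    Continuous (plLower V N κ A B (dataSeparation x)) ∧
      ∀ R, 0 < smallLambda V N ((sigmaMin A)⁻¹ * (dataSeparation x)⁻¹ * Real.exp (κ * R)) := by
  have hq : 0 < q := (pos_of_sigmaMin_pos hA).1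
  suffices h : Continuous (fun R => smallLambda V N
      ((sigmaMin A)⁻¹ * (dataSeparation x)⁻¹ * Real.exp (κ * R))) ∧
      ∀ R, 0 < smallLambda V N ((sigmaMin A)⁻¹ * (dataSeparation x)⁻¹ * Real.exp (κ * R)) by
    refine ⟨?_, h.2⟩
    have h1 := h.1
    unfold plLower
    fun_prop
  -- For N = 1 the argument of λ is 0, outside the range where continuity and positivity are known;
  -- but λ is then constant, and its value at 1 is positive.
  rcases subsingleton_or_nontrivial (Fin N) with h | h
  · simp only [fun s => smallLambda_eq_of_subsingleton (V := V) (N := N) s 1]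
    exact ⟨continuous_const, fun _ => smallLambda_pos hU one_pos⟩
  · have hpos : ∀ R, 0 < (sigmaMin A)⁻¹ * (dataSeparation x)⁻¹ * Real.exp (κ * R) := fun R => by
      have := dataSeparation_pos hx
      positivity
    exact ⟨(continuousOn_smallLambda hV hU hN hq).comp_continuous (by fun_prop) hpos,
      fun R => smallLambda_pos hU (hpos R)⟩

theorem hasLocalPL_empiricalRisk (hN : 0 < N) (hV : IsStronglyAdmissible V κ)
    (hU : IsUniversal V N) (A : Matrix (Fin q) (Fin d) ℝ) (B : Matrix (Fin d') (Fin q) ℝ)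
    (hA : 0 < sigmaMin A) {x : Fin N → Vec d} (hx : Function.Injective x) (y : Fin N → Vec d')
    (hB : 0 < sigmaMin B.transpose) :
    HasLocalPL (empiricalRisk (V := V) A B x y) (plLower V N κ A B (dataSeparation x))
      (plUpper V N κ B) := by
  have hN' : (0 : ℝ) < N := by exact_mod_cast hN
  have hq : 0 < q := (pos_of_sigmaMin_pos hA).1
  have hb := gradient_bounds hN hV hU A B hA x y
  obtain ⟨hcont, hpos⟩ := continuous_plLower_and_smallLambda_pos hN hV hU B hA hx
  refine ⟨fun v => ?_, fun v => (hb v).1, hcont.continuousOn, ?_, fun R _ => ?_, fun R _ => ?_,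
    fun v => (hb v).2⟩
  · unfold empiricalRisk
    positivity
  · unfold plUpper
    fun_prop
  · have := hpos R
    unfold plLower
    positivity
  · have h1 := hB.trans_le (sigmaMin_le_sigmaMax B.transpose)
    -- Λ dominates λ(s) for every s > 0; s = 1 is an arbitrary choice.
    have h2 : 0 < bigLambda V N :=
      (smallLambda_pos hU one_pos).trans_le (smallLambda_le_bigLambda hU hN hq one_pos)
    unfold plUpper
    positivity

end Risk

end FlowResNet

end

/-! ### The main theorem -/

theorem mainTheorem1 {q d d' N : ℕ} (hN : 1 ≤ N)
    (V : Type*) [NormedAddCommGroup V] [InnerProductSpace ℝ V] [CompleteSpace V]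
    [RKHS ℝ V (FlowResNet.Vec q) (FlowResNet.Vec q)]
    (κ : ℝ) (hV : FlowResNet.IsStronglyAdmissible V κ) (hU : FlowResNet.IsUniversal V N)
    (A : Matrix (Fin q) (Fin d) ℝ) (B : Matrix (Fin d') (Fin q) ℝ)
    (hA : 0 < FlowResNet.sigmaMin A)
    (x : Fin N → FlowResNet.Vec d) (hx : Function.Injective x)
    (y : Fin N → FlowResNet.Vec d') :
    -- the forward problem is well posed, so that the model and its risk are defined
    (∀ (v : FlowResNet.Control V) (x₀ : FlowResNet.Vec q),
      ∃ z : ℝ → FlowResNet.Vec q, FlowResNet.IsForwardSolution v x₀ z ∧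
        ∀ z' : ℝ → FlowResNet.Vec q, FlowResNet.IsForwardSolution v x₀ z' →
          Set.EqOn z' z (Set.Icc 0 1)) ∧
    -- the risk is differentiable and satisfies the two inequalities
    Differentiable ℝ (FlowResNet.empiricalRisk (V := V) A B x y) ∧
    (∀ v : FlowResNet.Control V,
      2 * FlowResNet.plLower V N κ A B (FlowResNet.dataSeparation x) ‖v‖ *
          FlowResNet.empiricalRisk A B x y v
        ≤ ‖gradient (FlowResNet.empiricalRisk A B x y) v‖ ^ 2 ∧
      ‖gradient (FlowResNet.empiricalRisk A B x y) v‖ ^ 2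
        ≤ 2 * FlowResNet.plUpper V N κ B ‖v‖ * FlowResNet.empiricalRisk A B x y v) ∧
    -- if `Bᵀ` is injective, the two bounds are moreover positive and continuous
    (0 < FlowResNet.sigmaMin B.transpose →
      FlowResNet.HasLocalPL (FlowResNet.empiricalRisk (V := V) A B x y)
        (FlowResNet.plLower V N κ A B (FlowResNet.dataSeparation x))
        (FlowResNet.plUpper V N κ B)) := by
  have hN' : 0 < N := hN
  have hb := FlowResNet.gradient_bounds hN' hV hU A B hA x y
  refine ⟨fun v x₀ => ?_, fun v => (hb v).1, fun v => (hb v).2,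
    FlowResNet.hasLocalPL_empiricalRisk hN' hV hU A B hA hx y⟩
  have hE := hV.isSmoothFamily
  have hv := MeasureTheory.Lp.memLp v
  obtain ⟨z, hz⟩ := FlowResNet.exists_isFlow hE hv x₀
  exact ⟨z, hz, fun z' hz' => FlowResNet.IsFlow.eqOn hE hv hz' hz⟩
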